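/- Let $n\ge 1$ and let all matrices be complex. For $n\times n$ matrices $A,B$ let $X_A(M)=AM$ and $\Delta_B(M)=B\circ M$ (entrywise product) be the corresponding operators on $n\times n$ matrices. The pair $(A,B)$ is a one-sided Jones pair if $X_A$ and $\Delta_B$ are invertible and $X_A\Delta_BX_A=\Delta_BX_A\Delta_B$; it is a Jones pair if $(A,B)$ and $(A,B^T)$ are both one-sided Jones pairs; a Jones pair is invertible if in addition $A$ has no zero entry and $B$ is an invertible matrix. For a matrix $A$ without zero entries, $A^{(-)}$ denotes its entrywise inverse. Let $\mathcal N_{A,B}$ be the space of matrices $M$ having every vector $Ae_i\circ Be_j$ as an eigenvector, let $T_{A,B}(M)$ be the matrix whose $(i,j)$ entry is the eigenvalue of $M$ on $Ae_i\circ Be_j$, and put $\mathcal N_A=\mathcal N_{A,A^{(-)}}$, $\Theta_A=T_{A,A^{(-)}}$. Let $(A,B)$ be an invertible Jones pair of $n\times n$ matrices with $A$ symmetric, let $d^2=n$, and let $$V=\begin{pmatrix} dA&-dA&B^{(-)}&B^{(-)}\\ -dA&dA&B^{(-)}&B^{(-)}\\ (B^{(-)})^T&(B^{(-)})^T&dA&-dA\\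 (B^{(-)})^T&(B^{(-)})^T&-dA&dA\end{pmatrix}.$$ Let $\widehat S$ be the set of all $4n\times4n$ matrices $$\begin{pmatrix} F+R&F-R&0&0\\ F-R&F+R&0&0\\ 0&0&B^{-1}FB+R_1&B^{-1}FB-R_1\\ 0&0&B^{-1}FB-R_1&B^{-1}FB+R_1\end{pmatrix}$$ with $F\in\mathcal N_A$, $R\in\mathcal N_{A,B}$ and $\Theta_{B^T}(A\circ R_1)^T=\Theta_A(A\circ R)$ (where it is understood that $A\circ R_1\in\mathcal N_{B^T}$ and $A\circ R\in\mathcal N_A$), and let $$\widehat J=\begin{pmatrix}0&0&J_n&J_n\\0&0&J_n&J_n\\J_n&J_n&0&0\\J_n&J_n&0&0\end{pmatrix},$$ where $J_n$ is the $n\times n$ all-ones matrix. Then the linear span $\mathcal B'$ of $\widehat S\cup\{\widehat J\}$ is a Bose–Mesner algebra, that is, the span of the adjacency matrices of a commutative association scheme on $4n$ points, and $\mathcal B'\subseteq\mathcal N_V$. If $r=\dim\mathcal N_A$, then $\dim\mathcal B'=2r+1$. -/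

import Mathlib

namespace JonesPair

open Matrix

noncomputable section

variable {ι : Type*}

/-- The entrywise (Schur) inverse `A⁽⁻⁾` of a matrix. -/
def schurInv (A : Matrix ι ι ℂ) : Matrix ι ι ℂ :=
  A.map fun x => x⁻¹

/-- The all-ones matrix. -/
def allOnes (ι : Type*) : Matrix ι ι ℂ :=
  Matrix.of fun _ _ => 1

/-- The operator `X_A : M ↦ A M` on square matrices. -/
def opX [Fintype ι] [DecidableEq ι] (A : Matrix ι ι ℂ) : Module.End ℂ (Matrix ι ι ℂ) :=
  LinearMap.mulLeft ℂ A

/-- The operator `Δ_B : M ↦ B ∘ M` (entrywise product) on square matrices. -/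
def opDelta (B : Matrix ι ι ℂ) : Module.End ℂ (Matrix ι ι ℂ) where
  toFun M := B ⊙ M
  map_add' M N := Matrix.hadamard_add B M N
  map_smul' c M := Matrix.hadamard_smul B M c

/-- `(A, B)` is a one-sided Jones pair: `X_A` and `Δ_B` are invertible and
`X_A Δ_B X_A = Δ_B X_A Δ_B`. -/
structure IsOneSidedJonesPair [Fintype ι] [DecidableEq ι] (A B : Matrix ι ι ℂ) : Prop where
  isUnit_opX : IsUnit (opX A)
  isUnit_opDelta : IsUnit (opDelta B)
  braid : opX A * opDelta B * opX A = opDelta B * opX A * opDelta B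

/-- `(A, B)` is a Jones pair: both `(A, B)` and `(A, Bᵀ)` are one-sided Jones pairs. -/
def IsJonesPair [Fintype ι] [DecidableEq ι] (A B : Matrix ι ι ℂ) : Prop :=
  IsOneSidedJonesPair A B ∧ IsOneSidedJonesPair A Bᵀ

/-- A Jones pair `(A, B)` is invertible if `A` has no zero entry and `B` is an invertible
matrix. -/
structure IsInvertibleJonesPair [Fintype ι] [DecidableEq ι] (A B : Matrix ι ι ℂ) : Prop where
  isJonesPair : IsJonesPair A B
  schurInvertible : ∀ i j, A i j ≠ 0
  isUnit : IsUnit B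

/-- The vector `A e_i ∘ B e_j`: entrywise product of column `i` of `A` and column `j` of `B`. -/
def evec (A B : Matrix ι ι ℂ) (i j : ι) : ι → ℂ :=
  fun k => A k i * B k j

/-- The space `N_{A,B}` of all matrices having every vector `A e_i ∘ B e_j` as an
eigenvector. -/
def nomuraPair [Fintype ι] (A B : Matrix ι ι ℂ) : Submodule ℂ (Matrix ι ι ℂ) where
  carrier := {M | ∀ i j, ∃ c : ℂ, M *ᵥ evec A B i j = c • evec A B i j}
  zero_mem' := fun _ _ => ⟨0, by simp⟩
  add_mem' := by
    intro M N hM hN i j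
    obtain ⟨c, hc⟩ := hM i j
    obtain ⟨e, he⟩ := hN i j
    exact ⟨c + e, by rw [Matrix.add_mulVec, hc, he, add_smul]⟩
  smul_mem' := by
    intro a M hM i j
    obtain ⟨c, hc⟩ := hM i j
    exact ⟨a * c, by rw [Matrix.smul_mulVec, hc, smul_smul]⟩

open Classical in
/-- The matrix `T_{A,B}(M)` of eigenvalues: for `M ∈ N_{A,B}`, its `(i, j)` entry is the
eigenvalue of `M` on `A e_i ∘ B e_j` (unique when that vector is nonzero). -/
def eigMatrix [Fintype ι] (A B M : Matrix ι ι ℂ) : Matrix ι ι ℂ :=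
  Matrix.of fun i j =>
    if h : ∃ c : ℂ, M *ᵥ evec A B i j = c • evec A B i j then h.choose else 0

/-- The Nomura algebra `N_A = N_{A, A⁽⁻⁾}`. -/
def nomura [Fintype ι] (A : Matrix ι ι ℂ) : Submodule ℂ (Matrix ι ι ℂ) :=
  nomuraPair A (schurInv A)

/-- The duality map `Θ_A = T_{A, A⁽⁻⁾}`. -/
def theta [Fintype ι] (A M : Matrix ι ι ℂ) : Matrix ι ι ℂ :=
  eigMatrix A (schurInv A) M

/-- The index set of the four groups of rows and columns of a `4n × 4n` matrix. -/
abbrev Four (ι : Type*) : Type _ := (ι ⊕ ι) ⊕ (ι ⊕ ι)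

/-- The `4n × 4n` matrix
```
 dA    -dA   B⁽⁻⁾   B⁽⁻⁾
-dA     dA   B⁽⁻⁾   B⁽⁻⁾
B⁽⁻⁾ᵀ  B⁽⁻⁾ᵀ   dA    -dA
B⁽⁻⁾ᵀ  B⁽⁻⁾ᵀ  -dA     dA
```
-/
def matV (d : ℂ) (A B : Matrix ι ι ℂ) : Matrix (Four ι) (Four ι) ℂ :=
  fromBlocks
    (fromBlocks (d • A) (-(d • A)) (-(d • A)) (d • A))
    (fromBlocks (schurInv B) (schurInv B) (schurInv B) (schurInv B))
    (fromBlocks (schurInv B)ᵀ (schurInv B)ᵀ (schurInv B)ᵀ (schurInv B)ᵀ)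
    (fromBlocks (d • A) (-(d • A)) (-(d • A)) (d • A))

/-- The block-diagonal `4n × 4n` matrix
```
F+R   F-R    0     0
F-R   F+R    0     0
 0     0    G+R₁  G-R₁
 0     0    G-R₁  G+R₁
```
-/
def blockMatrix (F R G R₁ : Matrix ι ι ℂ) : Matrix (Four ι) (Four ι) ℂ :=
  fromBlocks
    (fromBlocks (F + R) (F - R) (F - R) (F + R)) 0
    0 (fromBlocks (G + R₁) (G - R₁) (G - R₁) (G + R₁))

/-- The set `Ŝ` of the block-diagonal matrices with `F ∈ N_A`, `R ∈ N_{A,B}`, `G = B⁻¹FB` and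
`Θ_{Bᵀ}(A ∘ R₁)ᵀ = Θ_A(A ∘ R)`; the last equation includes that both arguments lie in the
domains `N_{Bᵀ}` and `N_A` of the two maps. -/
def hatS [Fintype ι] [DecidableEq ι] (A B : Matrix ι ι ℂ) : Set (Matrix (Four ι) (Four ι) ℂ) :=
  {Z | ∃ F R R₁ : Matrix ι ι ℂ,
    F ∈ nomura A ∧ R ∈ nomuraPair A B ∧
    A ⊙ R₁ ∈ nomura Bᵀ ∧ A ⊙ R ∈ nomura A ∧
    (theta Bᵀ (A ⊙ R₁))ᵀ = theta A (A ⊙ R) ∧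
    Z = blockMatrix F R (B⁻¹ * F * B) R₁}

/-- The matrix `Ĵ`, with zero diagonal and all-ones off-diagonal `2n × 2n` blocks. -/
def hatJ (ι : Type*) : Matrix (Four ι) (Four ι) ℂ :=
  fromBlocks 0 (allOnes (ι ⊕ ι)) (allOnes (ι ⊕ ι)) 0

/-- The span of `Ŝ ∪ {Ĵ}`. -/
def spanHat [Fintype ι] [DecidableEq ι] (A B : Matrix ι ι ℂ) :
    Submodule ℂ (Matrix (Four ι) (Four ι) ℂ) :=
  Submodule.span ℂ (hatS A B ∪ {hatJ ι})

/-- `E 0, …, E m` are the adjacency matrices of a (commutative) association scheme with `m`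
classes. -/
structure IsAssociationScheme {κ : Type*} [Fintype κ] [DecidableEq κ] {m : ℕ}
    (E : Fin (m + 1) → Matrix κ κ ℂ) : Prop where
  zero_or_one : ∀ k x y, E k x y = 0 ∨ E k x y = 1
  ne_zero : ∀ k, E k ≠ 0
  zero_eq_one : E 0 = 1
  sum_eq : ∑ k, E k = allOnes κ
  transpose_mem : ∀ k, ∃ l, (E k)ᵀ = E l
  mul_mem : ∀ k l, E k * E l ∈ Submodule.span ℂ (Set.range E)
  mul_comm : ∀ k l, E k * E l = E l * E k

/-- A Bose–Mesner algebra: the span of the adjacency matrices of an association scheme. -/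
def IsBoseMesnerAlgebra {κ : Type*} [Fintype κ] [DecidableEq κ]
    (𝓑 : Submodule ℂ (Matrix κ κ ℂ)) : Prop :=
  ∃ (m : ℕ) (E : Fin (m + 1) → Matrix κ κ ℂ),
    IsAssociationScheme E ∧ 𝓑 = Submodule.span ℂ (Set.range E)

end

end JonesPair

/-!
The braid relation `X_A Δ_B X_A = Δ_B X_A Δ_B` and membership in a Nomura space are both
star-triangle relations: identities `∑ w, L x w * M w y * N w z = c * (P x y * Q x z * R y z)`
between six matrices on the edges of a tetrahedron. Rotating the tetrahedron and exchanging the star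
with the triangle turn such relations into others, and two of them can be glued along a face. For
type II matrices this shows that Nomura spaces are commutative and behave well under transposition
and entrywise products, with eigenvalues of products and entrywise products exchanged by duality.

An invertible Jones pair consists of type II matrices, since the exchanged relation gives
`A ∘ (A⁻¹)ᵀ` rank one. If `A` is symmetric, entrywise multiplication by `A` identifies the odd parts
`(R, R₁)` of the matrices in `Ŝ` with the even parts `(F, B⁻¹FB)`. Hence the span is closed under
both products and transposition, is commutative and has dimension `2r + 1`. A commutative space of
matrices with these closure properties that contains `I` and `J` is a Bose–Mesner algebra: its
primitive idempotents for the entrywise product are the adjacency matrices. Finally, the vectors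
`V e_p ∘ V⁽⁻⁾ e_q` consist of blocks `f, ±f, g, ±g` with `f`, `g` eigenvectors of the even parts for
the sign `+` and of the odd parts for the sign `-`.
-/

namespace JonesPair

open Matrix

section StarTriangle

variable {ι : Type*}

@[simp]
theorem schurInv_apply (A : Matrix ι ι ℂ) (i j : ι) : schurInv A i j = (A i j)⁻¹ := rfl

@[simp]
theorem schurInv_schurInv (A : Matrix ι ι ℂ) : schurInv (schurInv A) = A := by
  ext i j
  simp

theorem transpose_schurInv (A : Matrix ι ι ℂ) : (schurInv A)ᵀ = schurInv Aᵀ := rfl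

theorem evec_ne_zero [Nonempty ι] {A B : Matrix ι ι ℂ} (hA : ∀ i j, A i j ≠ 0)
    (hB : ∀ i j, B i j ≠ 0) (i j : ι) : evec A B i j ≠ 0 := fun h =>
  mul_ne_zero (hA (Classical.arbitrary ι) i) (hB _ j) (congrFun h _)

variable [Fintype ι]

theorem mulVec_evec_apply (L M N : Matrix ι ι ℂ) (x y z : ι) :
    (L *ᵥ evec M N y z) x = ∑ w, L x w * M w y * N w z := by
  simp only [mulVec, dotProduct, evec, mul_assoc]

/-- The star-triangle relation with scale `c`: the matrices `L`, `M`, `N`, `P`, `Q`, `R` label the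
edges `xw`, `wy`, `wz`, `xy`, `xz`, `yz` of a tetrahedron. In the paper's notation it reads
`X_L Δ_N X_M = c Δ_Q X_P Δ_R`; written this way it can be subjected to the symmetries of the
tetrahedron. -/
def StarTriangle (c : ℂ) (L M N P Q R : Matrix ι ι ℂ) : Prop :=
  ∀ x y z, ∑ w, L x w * M w y * N w z = c * (P x y * Q x z * R y z)

namespace StarTriangle

variable {a c c' : ℂ} {L M N P Q R K U V W : Matrix ι ι ℂ}

theorem iff_mulVec_evec : StarTriangle c L M N P Q R ↔
    ∀ y z, L *ᵥ evec M N y z = (c * R y z) • evec P Q y z := by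
  simp only [StarTriangle, funext_iff, mulVec_evec_apply, Pi.smul_apply, evec, smul_eq_mul]
  constructor
  · intro h y z x
    rw [h]
    ring
  · intro h x y z
    rw [h]
    ring

theorem swap (h : StarTriangle c L M N P Q R) : StarTriangle c L N M Q P Rᵀ := by
  intro x y z
  calc ∑ w, L x w * N w y * M w z = ∑ w, L x w * M w z * N w y :=
        Finset.sum_congr rfl fun w _ => by ring
    _ = c * (Q x y * P x z * Rᵀ y z) := by rw [h, transpose_apply]; ring

theorem rotate (h : StarTriangle c L M N P Q R) : StarTriangle c Mᵀ Lᵀ N Pᵀ R Q := by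
  intro x y z
  calc ∑ w, Mᵀ x w * Lᵀ w y * N w z = ∑ w, L y w * M w x * N w z :=
        Finset.sum_congr rfl fun w _ => by simp only [transpose_apply]; ring
    _ = c * (Pᵀ x y * R x z * Q y z) := by rw [h, transpose_apply]; ring

theorem smul_star (h : StarTriangle c L M N P Q R) (a : ℂ) :
    StarTriangle (a * c) L M (a • N) P Q R := by
  intro x y z
  calc ∑ w, L x w * M w y * (a • N) w z = a * ∑ w, L x w * M w y * N w z := by
        rw [Finset.mul_sum]
        exact Finset.sum_congr rfl fun w _ => by rw [Matrix.smul_apply, smul_eq_mul]; ring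
    _ = a * c * (P x y * Q x z * R y z) := by rw [h]; ring

theorem exchange [DecidableEq ι] (h : StarTriangle c L M N P Q R) (hc : c ≠ 0)
    (hM : M * K = a • 1) (hQ : ∀ i j, Q i j ≠ 0) :
    StarTriangle (a / c) P K R L (schurInv Q) N := by
  intro x y z
  have inverted : c * Q x z * ∑ w, P x w * K w y * R w z = a * (L x y * N y z) :=
    calc c * Q x z * ∑ w, P x w * K w y * R w z
        = ∑ w, c * (P x w * Q x z * R w z) * K w y := by
          rw [Finset.mul_sum]
          exact Finset.sum_congr rfl fun w _ => by ring
      _ = ∑ w, ∑ v, L x v * N v z * (M v w * K w y) := by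
          simp only [← h x _ z, Finset.sum_mul]
          exact Finset.sum_congr rfl fun w _ => Finset.sum_congr rfl fun v _ => by ring
      _ = ∑ v, L x v * N v z * (M * K) v y := by
          simp only [mul_apply, Finset.mul_sum]
          exact Finset.sum_comm
      _ = a * (L x y * N y z) := by
          simp [hM, Matrix.one_apply, mul_comm a]
  rw [schurInv_apply, div_mul_eq_mul_div, eq_div_iff hc]
  field_simp [hQ x z]
  linear_combination inverted

theorem mul_right (h : StarTriangle c L M N P Q R) (h' : StarTriangle c' Q Rᵀ K U V W) :
    StarTriangle (c * c') L M (N * K) (P ⊙ U) V W := by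
  intro x y z
  calc ∑ w, L x w * M w y * (N * K) w z
      = ∑ v, (∑ w, L x w * M w y * N w v) * K v z := by
        simp only [mul_apply, Finset.mul_sum, Finset.sum_mul, ← mul_assoc]
        exact Finset.sum_comm
    _ = c * P x y * ∑ v, Q x v * Rᵀ v y * K v z := by
        rw [Finset.mul_sum]
        exact Finset.sum_congr rfl fun v _ => by rw [h, transpose_apply]; ring
    _ = c * c' * ((P ⊙ U) x y * V x z * W y z) := by
        rw [h', hadamard_apply]
        ring

theorem of_operator_eq [DecidableEq ι]
    (h : opX L * opDelta N * opX M = opDelta Q * opX P * opDelta R) :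
    StarTriangle 1 L M N P Q R := by
  intro x y z
  calc ∑ w, L x w * M w y * N w z
      = (opX L * opDelta N * opX M) (Matrix.single y z 1) x z := by
        simp [opX, opDelta, mul_apply, Matrix.single_apply, mul_left_comm, mul_comm]
    _ = (opDelta Q * opX P * opDelta R) (Matrix.single y z 1) x z := by rw [h]
    _ = 1 * (P x y * Q x z * R y z) := by
        simp [opX, opDelta, mul_apply, Matrix.single_apply, mul_left_comm, mul_comm]

end StarTriangle

end StarTriangle

section EigMatrix

variable {ι : Type*} [Fintype ι]

/-- `S` is a matrix of eigenvalues of `M`: its entry `(i, j)` is the eigenvalue of `M` on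
`A e_i ∘ B e_j`. A relational form of `T_{A,B}(M) = S`, which includes `M ∈ N_{A,B}`. -/
def IsEigMatrix (A B M S : Matrix ι ι ℂ) : Prop :=
  ∀ i j, M *ᵥ evec A B i j = S i j • evec A B i j

variable {A B F G M N P Q R S T X θ : Matrix ι ι ℂ} {c : ℂ}

theorem isEigMatrix_smul_iff : IsEigMatrix A B M (c • S) ↔ StarTriangle c M A B A B S :=
  StarTriangle.iff_mulVec_evec.symm

theorem isEigMatrix_iff : IsEigMatrix A B M S ↔ StarTriangle 1 M A B A B S := by
  rw [← isEigMatrix_smul_iff, one_smul]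

theorem mem_nomuraPair_iff : M ∈ nomuraPair A B ↔ ∃ S, IsEigMatrix A B M S := by
  constructor
  · intro h
    choose S hS using h
    exact ⟨of S, hS⟩
  · rintro ⟨S, hS⟩ i j
    exact ⟨S i j, hS i j⟩

namespace IsEigMatrix

theorem swap (h : IsEigMatrix A B M S) : IsEigMatrix B A M Sᵀ :=
  isEigMatrix_iff.mpr (isEigMatrix_iff.mp h).swap

theorem add (hM : IsEigMatrix A B M S) (hN : IsEigMatrix A B N T) :
    IsEigMatrix A B (M + N) (S + T) := fun i j => by
  rw [add_mulVec, hM, hN, Matrix.add_apply, add_smul]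

theorem smul (c : ℂ) (h : IsEigMatrix A B M S) : IsEigMatrix A B (c • M) (c • S) := fun i j => by
  rw [smul_mulVec, h, Matrix.smul_apply, smul_assoc]

theorem mul (hM : IsEigMatrix A B M S) (hN : IsEigMatrix A B N T) :
    IsEigMatrix A B (M * N) (S ⊙ T) := fun i j => by
  rw [← mulVec_mulVec, hN, mulVec_smul, hM, smul_smul, hadamard_apply, mul_comm]

theorem zero (A B : Matrix ι ι ℂ) : IsEigMatrix A B 0 0 := fun i j => by simp

theorem one [DecidableEq ι] (A B : Matrix ι ι ℂ) : IsEigMatrix A B 1 (allOnes ι) := fun i j => by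
  simp [allOnes]

theorem eigenvalue_unique (hA : ∀ i j, A i j ≠ 0) (hB : ∀ i j, B i j ≠ 0)
    (hS : IsEigMatrix A B M S) (hT : IsEigMatrix A B M T) : S = T := by
  ext i j
  have : Nonempty ι := ⟨i⟩
  exact smul_left_injective ℂ (evec_ne_zero hA hB i j) ((hS i j).symm.trans (hT i j))

theorem eigMatrix_eq (hA : ∀ i j, A i j ≠ 0) (hB : ∀ i j, B i j ≠ 0)
    (h : IsEigMatrix A B M S) : eigMatrix A B M = S := by
  refine eigenvalue_unique (M := M) hA hB (fun i j => ?_) h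
  have exists_eigenvalue : ∃ c : ℂ, M *ᵥ evec A B i j = c • evec A B i j := ⟨S i j, h i j⟩
  rw [eigMatrix, of_apply, dif_pos exists_eigenvalue]
  exact exists_eigenvalue.choose_spec

theorem transport (hc : c ≠ 0) (hR : ∀ i j, R i j ≠ 0) (hX : StarTriangle c X A B P Q R)
    (hF : IsEigMatrix A B F θ) (hGX : G * X = X * F) : IsEigMatrix P Q G θ := by
  intro i j
  have image := StarTriangle.iff_mulVec_evec.mp hX i j
  refine smul_right_injective _ (mul_ne_zero hc (hR i j)) ?_
  calc (c * R i j) • G *ᵥ evec P Q i j = (G * X) *ᵥ evec A B i j := by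
        rw [← mulVec_smul, ← image, mulVec_mulVec]
    _ = θ i j • X *ᵥ evec A B i j := by rw [hGX, ← mulVec_mulVec, hF, mulVec_smul]
    _ = (c * R i j) • θ i j • evec P Q i j := by rw [image, smul_comm]

end IsEigMatrix

end EigMatrix

section TypeII

variable {ι : Type*} [Fintype ι] [DecidableEq ι] {A B C D E M N S T : Matrix ι ι ℂ}

/-- A type II matrix: a matrix without zero entries whose entrywise inverse is, up to the factor
`n` and a transposition, its inverse. -/
structure IsTypeII (A : Matrix ι ι ℂ) : Prop where
  ne_zero : ∀ i j, A i j ≠ 0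
  mul_transpose_schurInv : A * (schurInv A)ᵀ = (Fintype.card ι : ℂ) • 1

theorem schurInv_ne_zero {ι : Type*} {A : Matrix ι ι ℂ} (hA : ∀ i j, A i j ≠ 0) (i j : ι) :
    schurInv A i j ≠ 0 := inv_ne_zero (hA i j)

theorem card_ne_zero (ι : Type*) [Fintype ι] [Nonempty ι] : (Fintype.card ι : ℂ) ≠ 0 :=
  Nat.cast_ne_zero.mpr Fintype.card_ne_zero

namespace IsTypeII

theorem schurInv (hA : IsTypeII A) : IsTypeII (schurInv A) where
  ne_zero := schurInv_ne_zero hA.ne_zero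
  mul_transpose_schurInv := by
    simpa using congrArg Matrix.transpose hA.mul_transpose_schurInv

section

variable [Nonempty ι]

theorem mul_smul_transpose_schurInv (hA : IsTypeII A) :
    A * ((Fintype.card ι : ℂ)⁻¹ • (JonesPair.schurInv A)ᵀ) = 1 := by
  rw [Matrix.mul_smul, hA.mul_transpose_schurInv, inv_smul_smul₀ (card_ne_zero ι)]

theorem inv_eq (hA : IsTypeII A) : A⁻¹ = (Fintype.card ι : ℂ)⁻¹ • (JonesPair.schurInv A)ᵀ :=
  inv_eq_right_inv hA.mul_smul_transpose_schurInv

theorem transpose_schurInv_mul (hA : IsTypeII A) :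
    (JonesPair.schurInv A)ᵀ * A = (Fintype.card ι : ℂ) • 1 := by
  rw [← mul_eq_one_comm.mp hA.mul_smul_transpose_schurInv, Matrix.smul_mul,
    smul_inv_smul₀ (card_ne_zero ι)]

theorem transpose (hA : IsTypeII A) : IsTypeII Aᵀ where
  ne_zero i j := hA.ne_zero j i
  mul_transpose_schurInv := by
    simpa [← JonesPair.transpose_schurInv] using
      congrArg Matrix.transpose hA.transpose_schurInv_mul

end

end IsTypeII

theorem IsEigMatrix.exchange (hA : IsTypeII A) (hB : ∀ i j, B i j ≠ 0)
    (h : IsEigMatrix A B M S) :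
    StarTriangle (Fintype.card ι) A (schurInv A)ᵀ S M (schurInv B) B := by
  simpa using (isEigMatrix_iff.mp h).exchange one_ne_zero hA.mul_transpose_schurInv hB

theorem IsEigMatrix.sum_column (hA : IsTypeII A) (hB : ∀ i j, B i j ≠ 0)
    (h : IsEigMatrix A B M S) (j x : ι) : ∑ i, S i j = Fintype.card ι * M x x := by
  simpa [hA.ne_zero, hB] using h.exchange hA hB x x j

theorem isEigMatrix_iff_exchange [Nonempty ι] (hA : IsTypeII A) (hB : ∀ i j, B i j ≠ 0) :
    IsEigMatrix A B M S ↔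
      StarTriangle (Fintype.card ι) A (schurInv A)ᵀ S M (schurInv B) B := by
  refine ⟨IsEigMatrix.exchange hA hB, fun h => ?_⟩
  have := h.exchange (card_ne_zero ι) hA.transpose_schurInv_mul (schurInv_ne_zero hB)
  rwa [div_self (card_ne_zero ι), schurInv_schurInv, ← isEigMatrix_iff] at this

namespace IsEigMatrix

variable [Nonempty ι]

theorem eq_of_eigenvalues (hA : IsTypeII A) (hB : ∀ i j, B i j ≠ 0) (hM : IsEigMatrix A B M S)
    (hN : IsEigMatrix A B N S) : M = N := by
  ext x y
  have := (hM.exchange hA hB x y x).symm.trans (hN.exchange hA hB x y x)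
  simpa [card_ne_zero, hB] using this

theorem commute (hA : IsTypeII A) (hB : ∀ i j, B i j ≠ 0) (hM : IsEigMatrix A B M S)
    (hN : IsEigMatrix A B N T) : M * N = N * M :=
  eq_of_eigenvalues hA hB (hM.mul hN) (hadamard_comm T S ▸ hN.mul hM)

/-- The exchanged star-triangle relation is invariant under the rotation of the tetrahedron, up to
inverting the entries of `A` and `B`. -/
theorem transpose (hA : IsTypeII A) (hB : ∀ i j, B i j ≠ 0) (h : IsEigMatrix A B M S) :
    IsEigMatrix (schurInv A) (schurInv B) Mᵀ S := by
  rw [isEigMatrix_iff_exchange hA.schurInv (schurInv_ne_zero hB), schurInv_schurInv,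
    schurInv_schurInv]
  exact (h.exchange hA hB).rotate

theorem hadamard (hC : IsTypeII C) (hD : IsTypeII D) (hE : ∀ i j, E i j ≠ 0)
    (hM : IsEigMatrix C D M S) (hN : IsEigMatrix (schurInv D) E N T) :
    IsEigMatrix C E (M ⊙ N) ((Fintype.card ι : ℂ)⁻¹ • (S * T)) := by
  have glued := (hM.exchange hC hD.ne_zero).mul_right
    (schurInv_schurInv D ▸ hN.exchange hD.schurInv hE)
  have := glued.smul_star (Fintype.card ι : ℂ)⁻¹
  rwa [inv_mul_cancel_left₀ (card_ne_zero ι), ← isEigMatrix_iff_exchange hC hE] at this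

theorem allOnes (hC : IsTypeII C) :
    IsEigMatrix C (schurInv C) (allOnes ι) ((Fintype.card ι : ℂ) • 1) := by
  rw [isEigMatrix_smul_iff]
  intro x y z
  have entry := congrFun₂ hC.transpose_schurInv_mul z y
  simp only [mul_apply, transpose_apply] at entry
  rcases eq_or_ne y z with rfl | hyz
  · simp [JonesPair.allOnes, hC.ne_zero]
  · simpa [JonesPair.allOnes, hyz, hyz.symm, mul_comm] using entry

end IsEigMatrix

theorem IsEigMatrix.mul_allOnes {ι : Type*} [Fintype ι] {C M S : Matrix ι ι ℂ}
    (hC : ∀ i j, C i j ≠ 0) (h : IsEigMatrix C (JonesPair.schurInv C) M S) (i : ι) :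
    M * JonesPair.allOnes ι = S i i • JonesPair.allOnes ι := by
  ext x y
  have := congrFun (h i i) x
  simpa [JonesPair.allOnes, mulVec, dotProduct, mul_apply, evec, hC] using this

theorem card_mul_mul_eq_one_of_sum_eq_one {ι K : Type*} [Fintype ι] [CommSemiring K] {u v : ι → K}
    (hrow : ∀ x, ∑ i, u x * v i = 1) (hcol : ∀ i, ∑ x, u x * v i = 1) (x i : ι) :
    Fintype.card ι * (u x * v i) = 1 := by
  calc Fintype.card ι * (u x * v i) = ∑ y, u x * v i * ∑ j, u y * v j := by simp [hrow]
    _ = ∑ j, ∑ y, u x * v j * (u y * v i) := by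
      simp only [Finset.mul_sum]
      rw [Finset.sum_comm]
      exact Finset.sum_congr rfl fun j _ => Finset.sum_congr rfl fun y _ => by ring
    _ = (∑ j, u x * v j) * ∑ y, u y * v i := (Finset.sum_mul_sum _ _ _ _).symm
    _ = 1 := by rw [hrow, hcol, mul_one]

/-- The exchange with the inverse of `A` shows that `A ∘ (A⁻¹)ᵀ` has rank one; since its rows and
columns sum to `1`, it is constant. -/
theorem IsEigMatrix.isTypeII_left (hA : IsUnit A) (hB : ∀ i j, B i j ≠ 0) (hS : IsUnit S)
    (h : IsEigMatrix A B M S) : IsTypeII A := by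
  rw [isUnit_iff_isUnit_det] at hA hS
  have hAA : A * A⁻¹ = 1 := mul_nonsing_inv A hA
  have mul_eigenvalues : (A ⊙ A⁻¹ᵀ) * S = vecMulVec M.diag 1 := by
    ext x z
    have := (isEigMatrix_iff.mp h).exchange (a := 1) one_ne_zero (by rwa [one_smul]) hB x x z
    simpa [mul_apply, vecMulVec_apply, hB] using this
  have rank_one : A ⊙ A⁻¹ᵀ = vecMulVec M.diag (1 ᵥ* S⁻¹) := by
    rw [← mul_nonsing_inv_cancel_right S (A ⊙ A⁻¹ᵀ) hS, mul_eigenvalues, vecMulVec_mul]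
  have factorization : ∀ x i, A x i * A⁻¹ i x = M.diag x * (1 ᵥ* S⁻¹) i := congrFun₂ rank_one
  have entry : ∀ x i, Fintype.card ι * (A x i * A⁻¹ i x) = 1 := by
    intro x i
    rw [factorization]
    refine card_mul_mul_eq_one_of_sum_eq_one (fun x => ?_) (fun i => ?_) x i
    · simpa only [← factorization, mul_apply, one_apply_eq] using congrFun₂ hAA x x
    · simpa only [← factorization, mul_apply, one_apply_eq, mul_comm] using
        congrFun₂ (nonsing_inv_mul A hA) i i
  have ne_zero : ∀ i j, A i j ≠ 0 := fun i j hij => by simpa [hij] using entry i j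
  have schurInv_eq : (schurInv A)ᵀ = (Fintype.card ι : ℂ) • A⁻¹ := by
    ext i x
    rw [transpose_apply, schurInv_apply, Matrix.smul_apply, smul_eq_mul]
    exact inv_eq_of_mul_eq_one_right (by linear_combination entry x i)
  exact ⟨ne_zero, by rw [schurInv_eq, Matrix.mul_smul, hAA]⟩

theorem IsEigMatrix.isTypeII_right [Nonempty ι] {r : ℂ} (hA : IsTypeII A)
    (hB : ∀ i j, B i j ≠ 0) (hM : ∀ i j, M i j ≠ 0) (hS : ∀ i, ∑ j, S i j = r)
    (h : IsEigMatrix A B M S) : IsTypeII B := by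
  refine ⟨hB, ?_⟩
  ext y x
  rcases eq_or_ne y x with rfl | hyx
  · simp [mul_apply, hB]
  have vanishing : Fintype.card ι * M x y * (B * (schurInv B)ᵀ) y x = 0 :=
    calc Fintype.card ι * M x y * (B * (schurInv B)ᵀ) y x
        = ∑ z, ∑ w, A x w * (schurInv A)ᵀ w y * S w z := by
          simp only [mul_apply, Finset.mul_sum, h.exchange hA hB x y]
          exact Finset.sum_congr rfl fun z _ => by rw [transpose_apply]; ring
      _ = (A * (schurInv A)ᵀ) x y * r := by
          rw [Finset.sum_comm]
          simp only [← Finset.mul_sum, hS, mul_apply, Finset.sum_mul]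
      _ = 0 := by simp [hA.mul_transpose_schurInv, hyx.symm]
  simpa [card_ne_zero, hM, hyx] using vanishing

end TypeII

section JonesPairs

variable {ι : Type*} [Fintype ι] [DecidableEq ι] {A B F θ : Matrix ι ι ℂ}

theorem ne_zero_of_isUnit_opDelta {ι : Type*} {B : Matrix ι ι ℂ} (hB : IsUnit (opDelta B))
    (i j : ι) : B i j ≠ 0 := by
  obtain ⟨M, hM⟩ := ((Module.End.isUnit_iff _).mp hB).surjective (allOnes ι)
  exact left_ne_zero_of_mul_eq_one (congrFun₂ hM i j)

namespace IsInvertibleJonesPair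

theorem transpose (h : IsInvertibleJonesPair A B) : IsInvertibleJonesPair A Bᵀ where
  isJonesPair := ⟨h.isJonesPair.2, h.isJonesPair.1⟩
  schurInvertible := h.schurInvertible
  isUnit := isUnit_transpose B |>.mpr h.isUnit

theorem right_ne_zero (h : IsInvertibleJonesPair A B) : ∀ i j, B i j ≠ 0 :=
  ne_zero_of_isUnit_opDelta h.isJonesPair.1.isUnit_opDelta

theorem isEigMatrix (h : IsInvertibleJonesPair A B) : IsEigMatrix A B A B :=
  isEigMatrix_iff.mpr (StarTriangle.of_operator_eq h.isJonesPair.1.braid)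

theorem isTypeII_left (h : IsInvertibleJonesPair A B) : IsTypeII A :=
  h.isEigMatrix.isTypeII_left (Algebra.lmul_isUnit_iff.mp h.isJonesPair.1.isUnit_opX)
    h.right_ne_zero h.isUnit

theorem isEigMatrix_schurInv (h : IsInvertibleJonesPair A B) (hA : A.IsSymm) :
    IsEigMatrix A B (schurInv A) ((Fintype.card ι : ℂ) • schurInv B) := by
  have rotated := (h.isEigMatrix.exchange h.isTypeII_left h.right_ne_zero).rotate
  rwa [transpose_transpose, hA.eq, ← isEigMatrix_smul_iff] at rotated

variable [Nonempty ι]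

theorem isTypeII_right (h : IsInvertibleJonesPair A B) : IsTypeII B :=
  h.isEigMatrix.isTypeII_right h.isTypeII_left h.right_ne_zero h.schurInvertible fun i =>
    h.transpose.isEigMatrix.sum_column h.isTypeII_left h.transpose.right_ne_zero i
      (Classical.arbitrary ι)

/-- The exchanged form of `isEigMatrix_schurInv` is, in another rotation, a relation whose operator
`(B⁽⁻⁾)ᵀ` is a multiple of `B⁻¹`. -/
theorem isEigMatrix_conj (h : IsInvertibleJonesPair A B) (hA : A.IsSymm)
    (hF : IsEigMatrix A (schurInv A) F θ) :
    IsEigMatrix (schurInv B)ᵀ Bᵀ (B⁻¹ * F * B) θ := by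
  have hB := h.isTypeII_right
  have intertwiner : StarTriangle 1 (schurInv B)ᵀ A (schurInv A) (schurInv B)ᵀ Bᵀ (schurInv A) := by
    have := (isEigMatrix_smul_iff.mp (h.isEigMatrix_schurInv hA)).exchange (card_ne_zero ι)
      h.isTypeII_left.mul_transpose_schurInv h.right_ne_zero
    rw [div_self (card_ne_zero ι), transpose_schurInv, hA.eq] at this
    simpa only [hA.eq] using this.swap.rotate
  refine hF.transport one_ne_zero (schurInv_ne_zero h.schurInvertible) intertwiner ?_
  have : (schurInv B)ᵀ = (Fintype.card ι : ℂ) • B⁻¹ := by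
    rw [hB.inv_eq, smul_inv_smul₀ (card_ne_zero ι)]
  rw [this, Matrix.mul_smul, Matrix.smul_mul,
    mul_nonsing_inv_cancel_right B _ ((isUnit_iff_isUnit_det B).mp h.isUnit)]

end IsInvertibleJonesPair

end JonesPairs

section PairedNomura

variable {ι : Type*} [Fintype ι] {C D E C' D' E' F G F' G' : Matrix ι ι ℂ}

/-- The pairs `(F, G)` with `F ∈ N_{C,D}`, `G ∈ N_{C',D'}` and the same matrix of eigenvalues.
Both halves of `Ŝ` are of this form, see `evenPairs` and `oddPairs`. -/
def pairedNomura (C D C' D' : Matrix ι ι ℂ) : Submodule ℂ (Matrix ι ι ℂ × Matrix ι ι ℂ) where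
  carrier := {p | ∃ S, IsEigMatrix C D p.1 S ∧ IsEigMatrix C' D' p.2 S}
  zero_mem' := ⟨0, .zero C D, .zero C' D'⟩
  add_mem' := fun ⟨_, hF, hG⟩ ⟨_, hF', hG'⟩ => ⟨_, hF.add hF', hG.add hG'⟩
  smul_mem' := fun c _ ⟨_, hF, hG⟩ => ⟨_, hF.smul c, hG.smul c⟩

namespace pairedNomura

theorem symm (h : (F, G) ∈ pairedNomura C D C' D') : (G, F) ∈ pairedNomura C' D' C D :=
  let ⟨S, hF, hG⟩ := h
  ⟨S, hG, hF⟩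

theorem reverse (h : (F, G) ∈ pairedNomura C D C' D') : (F, G) ∈ pairedNomura D C D' C' :=
  let ⟨S, hF, hG⟩ := h
  ⟨Sᵀ, hF.swap, hG.swap⟩

theorem mul_mem (h : (F, G) ∈ pairedNomura C D C' D') (h' : (F', G') ∈ pairedNomura C D C' D') :
    (F * F', G * G') ∈ pairedNomura C D C' D' :=
  let ⟨S, hF, hG⟩ := h
  let ⟨S', hF', hG'⟩ := h'
  ⟨S ⊙ S', hF.mul hF', hG.mul hG'⟩

variable [DecidableEq ι]

theorem one_mem (C D C' D' : Matrix ι ι ℂ) : (1, 1) ∈ pairedNomura C D C' D' :=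
  ⟨allOnes ι, .one C D, .one C' D'⟩

variable [Nonempty ι]

theorem commute (hC : IsTypeII C) (hD : ∀ i j, D i j ≠ 0) (hC' : IsTypeII C')
    (hD' : ∀ i j, D' i j ≠ 0) (h : (F, G) ∈ pairedNomura C D C' D')
    (h' : (F', G') ∈ pairedNomura C D C' D') : F * F' = F' * F ∧ G * G' = G' * G :=
  let ⟨_, hF, hG⟩ := h
  let ⟨_, hF', hG'⟩ := h'
  ⟨hF.commute hC hD hF', hG.commute hC' hD' hG'⟩

theorem transpose_mem (hC : IsTypeII C) (hD : ∀ i j, D i j ≠ 0) (hC' : IsTypeII C')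
    (hD' : ∀ i j, D' i j ≠ 0) (h : (F, G) ∈ pairedNomura C D C' D') :
    (Fᵀ, Gᵀ) ∈ pairedNomura (schurInv C) (schurInv D) (schurInv C') (schurInv D') :=
  let ⟨S, hF, hG⟩ := h
  ⟨S, hF.transpose hC hD, hG.transpose hC' hD'⟩

theorem hadamard_mem (hC : IsTypeII C) (hD : IsTypeII D) (hE : ∀ i j, E i j ≠ 0)
    (hC' : IsTypeII C') (hD' : IsTypeII D') (hE' : ∀ i j, E' i j ≠ 0)
    (h : (F, G) ∈ pairedNomura C D C' D')
    (h' : (F', G') ∈ pairedNomura (schurInv D) E (schurInv D') E') :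
    (F ⊙ F', G ⊙ G') ∈ pairedNomura C E C' E' :=
  let ⟨_, hF, hG⟩ := h
  let ⟨_, hF', hG'⟩ := h'
  ⟨_, hF.hadamard hC hD hE hF', hG.hadamard hC' hD' hE' hG'⟩

end pairedNomura

/-- The pairs `(F, G)` of matrices of `N_A` and `N_{Bᵀ}` with `Θ_{Bᵀ}(G)ᵀ = Θ_A(F)`: the even parts
of the block matrices in `Ŝ`. -/
noncomputable def evenPairs (A B : Matrix ι ι ℂ) : Submodule ℂ (Matrix ι ι ℂ × Matrix ι ι ℂ) :=
  pairedNomura A (schurInv A) (schurInv B)ᵀ Bᵀ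

/-- The odd parts `(R, R₁)` of the block matrices in `Ŝ`, described by `R ∈ N_{A,B}` and an
eigenvalue condition on `R₁` itself rather than on `A ∘ R₁`. -/
noncomputable def oddPairs (A B : Matrix ι ι ℂ) : Submodule ℂ (Matrix ι ι ℂ × Matrix ι ι ℂ) :=
  pairedNomura A B (schurInv B)ᵀ (schurInv A)

end PairedNomura

namespace IsInvertibleJonesPair

variable {ι : Type*} [Fintype ι] [DecidableEq ι]
  {A B E E' F G F' G' R R₁ R' R₁' M N S : Matrix ι ι ℂ}

theorem mem_evenPairs_iff_theta (h : IsInvertibleJonesPair A B) :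
    (F, G) ∈ evenPairs A B ↔
      F ∈ nomura A ∧ G ∈ nomura Bᵀ ∧ (theta Bᵀ G)ᵀ = theta A F := by
  have theta_left {S : Matrix ι ι ℂ} (hF : IsEigMatrix A (schurInv A) F S) : theta A F = S :=
    hF.eigMatrix_eq h.schurInvertible (schurInv_ne_zero h.schurInvertible)
  have theta_right {S : Matrix ι ι ℂ} (hG : IsEigMatrix Bᵀ (schurInv B)ᵀ G S) : theta Bᵀ G = S :=
    hG.eigMatrix_eq h.transpose.right_ne_zero (schurInv_ne_zero h.transpose.right_ne_zero)
  constructor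
  · rintro ⟨S, hF, hG⟩
    exact ⟨mem_nomuraPair_iff.mpr ⟨S, hF⟩, mem_nomuraPair_iff.mpr ⟨Sᵀ, hG.swap⟩,
      by rw [theta_left hF, theta_right hG.swap, transpose_transpose]⟩
  · rintro ⟨hF, hG, htheta⟩
    obtain ⟨S, hF⟩ := mem_nomuraPair_iff.mp hF
    obtain ⟨T, hG⟩ := mem_nomuraPair_iff.mp hG
    rw [theta_left hF, theta_right hG] at htheta
    exact ⟨S, hF, htheta ▸ hG.swap⟩

variable [Nonempty ι]

theorem commute_of_mem_evenPairs (h : IsInvertibleJonesPair A B) (hF : (F, G) ∈ evenPairs A B)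
    (hF' : (F', G') ∈ evenPairs A B) : F * F' = F' * F ∧ G * G' = G' * G :=
  pairedNomura.commute h.isTypeII_left (schurInv_ne_zero h.schurInvertible)
    h.isTypeII_right.schurInv.transpose h.transpose.right_ne_zero hF hF'

theorem commute_of_mem_oddPairs (h : IsInvertibleJonesPair A B) (hR : (R, R₁) ∈ oddPairs A B)
    (hR' : (R', R₁') ∈ oddPairs A B) : R * R' = R' * R ∧ R₁ * R₁' = R₁' * R₁ :=
  pairedNomura.commute h.isTypeII_left h.right_ne_zero h.isTypeII_right.schurInv.transpose
    (schurInv_ne_zero h.schurInvertible) hR hR'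

theorem allOnes_mem_evenPairs (h : IsInvertibleJonesPair A B) :
    (allOnes ι, allOnes ι) ∈ evenPairs A B := by
  have right := IsEigMatrix.allOnes h.isTypeII_right.schurInv.transpose
  rw [← transpose_schurInv, schurInv_schurInv] at right
  exact ⟨_, .allOnes h.isTypeII_left, right⟩

theorem transpose_mem_evenPairs (h : IsInvertibleJonesPair A B) (hF : (F, G) ∈ evenPairs A B) :
    (Fᵀ, Gᵀ) ∈ evenPairs A B := by
  have := pairedNomura.transpose_mem h.isTypeII_left (schurInv_ne_zero h.schurInvertible)
    h.isTypeII_right.schurInv.transpose h.transpose.right_ne_zero hF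
  simp only [← transpose_schurInv, schurInv_schurInv] at this
  exact pairedNomura.reverse this

/-- Both components of a pair carry the eigenvalue of the all-ones vector, a common diagonal
entry of their matrix of eigenvalues. -/
theorem exists_mul_allOnes (h : IsInvertibleJonesPair A B) (hF : (F, G) ∈ evenPairs A B) :
    ∃ c : ℂ, F * allOnes ι = c • allOnes ι ∧ G * allOnes ι = c • allOnes ι := by
  obtain ⟨S, hFS, hGS⟩ := hF
  rw [← schurInv_schurInv Bᵀ] at hGS
  exact ⟨_, hFS.mul_allOnes h.schurInvertible (Classical.arbitrary ι),
    hGS.mul_allOnes (schurInv_ne_zero h.transpose.right_ne_zero) _⟩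

theorem hadamard_evenPair_mem (h : IsInvertibleJonesPair A B) (hE : ∀ i j, E i j ≠ 0)
    (hE' : ∀ i j, E' i j ≠ 0) (hF : (F, G) ∈ evenPairs A B)
    (hR : (R, R₁) ∈ pairedNomura A E (schurInv B)ᵀ E') :
    (F ⊙ R, G ⊙ R₁) ∈ pairedNomura A E (schurInv B)ᵀ E' := by
  refine pairedNomura.hadamard_mem h.isTypeII_left h.isTypeII_left.schurInv hE
    h.isTypeII_right.schurInv.transpose h.isTypeII_right.transpose hE' hF ?_
  rwa [schurInv_schurInv]

theorem hadamard_mem_evenPairs (h : IsInvertibleJonesPair A B) (hF : (F, G) ∈ evenPairs A B)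
    (hF' : (F', G') ∈ evenPairs A B) : (F ⊙ F', G ⊙ G') ∈ evenPairs A B :=
  h.hadamard_evenPair_mem (schurInv_ne_zero h.schurInvertible) h.transpose.right_ne_zero hF hF'

theorem hadamard_mem_oddPairs (h : IsInvertibleJonesPair A B) (hF : (F, G) ∈ evenPairs A B)
    (hR : (R, R₁) ∈ oddPairs A B) : (F ⊙ R, G ⊙ R₁) ∈ oddPairs A B :=
  h.hadamard_evenPair_mem h.right_ne_zero (schurInv_ne_zero h.schurInvertible) hF hR

theorem hadamard_dual_mem_evenPairs (h : IsInvertibleJonesPair A B) (hR : (R, R₁) ∈ oddPairs A B)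
    (hR' : (R₁', R') ∈ oddPairs A Bᵀ) : (R ⊙ R', R₁ ⊙ R₁') ∈ evenPairs A B := by
  refine pairedNomura.hadamard_mem h.isTypeII_left h.isTypeII_right
    (schurInv_ne_zero h.schurInvertible) h.isTypeII_right.schurInv.transpose
    h.isTypeII_left.schurInv h.transpose.right_ne_zero hR ?_
  rw [schurInv_schurInv]
  exact pairedNomura.symm hR'

theorem transpose_mem_oddPairs_transpose (h : IsInvertibleJonesPair A B)
    (hR : (R, R₁) ∈ oddPairs A B) : (R₁ᵀ, Rᵀ) ∈ oddPairs A Bᵀ := by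
  have := pairedNomura.transpose_mem h.isTypeII_left h.right_ne_zero
    h.isTypeII_right.schurInv.transpose (schurInv_ne_zero h.schurInvertible) hR
  simp only [← transpose_schurInv, schurInv_schurInv] at this
  exact pairedNomura.symm (pairedNomura.reverse this)

theorem mem_oddPairs_of_isEigMatrix (h : IsInvertibleJonesPair A B) (hM : IsEigMatrix A B M S)
    (hN : IsEigMatrix A Bᵀ N Sᵀ) : (M, Nᵀ) ∈ oddPairs A B :=
  ⟨S, hM, (hN.transpose h.isTypeII_left h.transpose.right_ne_zero).swap⟩

theorem self_mem_oddPairs (h : IsInvertibleJonesPair A B) (hA : A.IsSymm) :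
    (A, A) ∈ oddPairs A B := by
  simpa only [hA.eq] using h.mem_oddPairs_of_isEigMatrix h.isEigMatrix h.transpose.isEigMatrix

theorem schurInv_mem_oddPairs (h : IsInvertibleJonesPair A B) (hA : A.IsSymm) :
    (schurInv A, schurInv A) ∈ oddPairs A B := by
  simpa only [transpose_schurInv, hA.eq] using h.mem_oddPairs_of_isEigMatrix
    (h.isEigMatrix_schurInv hA) (h.transpose.isEigMatrix_schurInv hA)

theorem mem_oddPairs_iff (h : IsInvertibleJonesPair A B) (hA : A.IsSymm) :
    (R, R₁) ∈ oddPairs A B ↔ (A ⊙ R, A ⊙ R₁) ∈ evenPairs A B := by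
  constructor
  · intro hR
    rw [hadamard_comm A, hadamard_comm A]
    exact h.hadamard_dual_mem_evenPairs hR (h.transpose.self_mem_oddPairs hA)
  · intro hR
    have cancel (M : Matrix ι ι ℂ) : A ⊙ M ⊙ schurInv A = M := by
      ext i j
      exact mul_div_cancel_left₀ (M i j) (h.schurInvertible i j)
    simpa only [cancel] using h.hadamard_mem_oddPairs hR (h.schurInv_mem_oddPairs hA)

theorem transpose_mem_oddPairs (h : IsInvertibleJonesPair A B) (hA : A.IsSymm)
    (hR : (R, R₁) ∈ oddPairs A B) : (Rᵀ, R₁ᵀ) ∈ oddPairs A B := by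
  rw [h.mem_oddPairs_iff hA] at hR ⊢
  simpa only [transpose_hadamard, hA.eq] using h.transpose_mem_evenPairs hR

theorem swap_mem_oddPairs (h : IsInvertibleJonesPair A B) (hA : A.IsSymm)
    (hR : (R, R₁) ∈ oddPairs A B) : (R₁, R) ∈ oddPairs A Bᵀ := by
  simpa only [transpose_transpose] using
    h.transpose.transpose_mem_oddPairs hA (h.transpose_mem_oddPairs_transpose hR)

theorem swap_mem_evenPairs (h : IsInvertibleJonesPair A B) (hA : A.IsSymm)
    (hF : (F, G) ∈ evenPairs A B) : (G, F) ∈ evenPairs A Bᵀ := by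
  have cancel (M : Matrix ι ι ℂ) : A ⊙ (schurInv A ⊙ M) = M := by
    ext i j
    simp [h.schurInvertible]
  have odd : (schurInv A ⊙ F, schurInv A ⊙ G) ∈ oddPairs A B := by
    rwa [h.mem_oddPairs_iff hA, cancel, cancel]
  simpa only [h.transpose.mem_oddPairs_iff hA, cancel] using h.swap_mem_oddPairs hA odd

theorem hadamard_odd_mem_evenPairs (h : IsInvertibleJonesPair A B) (hA : A.IsSymm)
    (hR : (R, R₁) ∈ oddPairs A B) (hR' : (R', R₁') ∈ oddPairs A B) :
    (R ⊙ R', R₁ ⊙ R₁') ∈ evenPairs A B :=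
  h.hadamard_dual_mem_evenPairs hR (h.swap_mem_oddPairs hA hR')

theorem mem_evenPairs_iff_conj (h : IsInvertibleJonesPair A B) (hA : A.IsSymm) :
    (F, G) ∈ evenPairs A B ↔ F ∈ nomura A ∧ G = B⁻¹ * F * B := by
  constructor
  · rintro ⟨S, hF, hG⟩
    exact ⟨mem_nomuraPair_iff.mpr ⟨S, hF⟩,
      hG.eq_of_eigenvalues h.isTypeII_right.schurInv.transpose h.transpose.right_ne_zero
        (h.isEigMatrix_conj hA hF)⟩
  · rintro ⟨hF, rfl⟩
    obtain ⟨S, hF⟩ := mem_nomuraPair_iff.mp hF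
    exact ⟨S, hF, h.isEigMatrix_conj hA hF⟩

theorem mem_hatS_iff (h : IsInvertibleJonesPair A B) (hA : A.IsSymm)
    {Z : Matrix (Four ι) (Four ι) ℂ} :
    Z ∈ hatS A B ↔ ∃ F G R R₁, (F, G) ∈ evenPairs A B ∧ (R, R₁) ∈ oddPairs A B ∧
      Z = blockMatrix F R G R₁ := by
  constructor
  · rintro ⟨F, R, R₁, hF, -, hR₁, hR, htheta, rfl⟩
    exact ⟨F, _, R, R₁, (h.mem_evenPairs_iff_conj hA).mpr ⟨hF, rfl⟩,
      (h.mem_oddPairs_iff hA).mpr (h.mem_evenPairs_iff_theta.mpr ⟨hR, hR₁, htheta⟩), rfl⟩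
  · rintro ⟨F, G, R, R₁, hF, hR, rfl⟩
    obtain ⟨hFA, rfl⟩ := (h.mem_evenPairs_iff_conj hA).mp hF
    obtain ⟨hAR, hAR₁, htheta⟩ := h.mem_evenPairs_iff_theta.mp ((h.mem_oddPairs_iff hA).mp hR)
    obtain ⟨S, hRS, -⟩ := hR
    exact ⟨F, R, R₁, hFA, mem_nomuraPair_iff.mpr ⟨S, hRS⟩, hAR₁, hAR, htheta, rfl⟩

end IsInvertibleJonesPair

section BoseMesner

variable {κ : Type*}

/-- Two positions are equivalent for `𝓑` when every matrix of `𝓑` has the same entry at both; for a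
Bose–Mesner algebra the classes are the relations of the scheme. -/
def entrySetoid (𝓑 : Submodule ℂ (Matrix κ κ ℂ)) : Setoid (κ × κ) :=
  Setoid.ker fun p (M : 𝓑) => M.1 p.1 p.2

open Classical in
/-- The zero-one matrix supported on one class of positions: an adjacency matrix of the scheme. -/
noncomputable def classMatrix (𝓑 : Submodule ℂ (Matrix κ κ ℂ)) (c : Quotient (entrySetoid 𝓑)) :
    Matrix κ κ ℂ :=
  of fun x y => if Quotient.mk _ (x, y) = c then 1 else 0

variable {𝓑 : Submodule ℂ (Matrix κ κ ℂ)}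

theorem mk_eq_mk_iff {p q : κ × κ} :
    Quotient.mk (entrySetoid 𝓑) p = Quotient.mk _ q ↔ ∀ M ∈ 𝓑, M p.1 p.2 = M q.1 q.2 := by
  rw [Quotient.eq, entrySetoid, Setoid.ker_def, funext_iff, Subtype.forall]

theorem classMatrix_eq_zero_or_one (c : Quotient (entrySetoid 𝓑)) (x y : κ) :
    classMatrix 𝓑 c x y = 0 ∨ classMatrix 𝓑 c x y = 1 := by
  rw [classMatrix, of_apply]
  split_ifs
  · exact .inr rfl
  · exact .inl rfl

theorem classMatrix_ne_zero (c : Quotient (entrySetoid 𝓑)) : classMatrix 𝓑 c ≠ 0 := by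
  obtain ⟨⟨x, y⟩, rfl⟩ := Quotient.exists_rep c
  intro h
  simpa [classMatrix] using congrFun₂ h x y

theorem exists_separating_mem (h_ones : allOnes κ ∈ 𝓑) {p q : κ × κ}
    (hpq : Quotient.mk (entrySetoid 𝓑) q ≠ Quotient.mk _ p) :
    ∃ M ∈ 𝓑, M p.1 p.2 = 1 ∧ M q.1 q.2 = 0 := by
  rw [Ne, mk_eq_mk_iff] at hpq
  push Not at hpq
  obtain ⟨M, hM, hne⟩ := hpq
  refine ⟨(M p.1 p.2 - M q.1 q.2)⁻¹ • (M - M q.1 q.2 • allOnes κ),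
    𝓑.smul_mem _ (𝓑.sub_mem hM (𝓑.smul_mem _ h_ones)), ?_, ?_⟩
  · simp [allOnes, inv_mul_cancel₀ (sub_ne_zero.mpr hne.symm)]
  · simp [allOnes]

theorem hadamard_prod_mem (h_ones : allOnes κ ∈ 𝓑) (h_had : ∀ M ∈ 𝓑, ∀ N ∈ 𝓑, M ⊙ N ∈ 𝓑)
    {σ : Type*} (t : Finset σ) {f : σ → Matrix κ κ ℂ} (hf : ∀ q, f q ∈ 𝓑) :
    (of fun x y => ∏ q ∈ t, f q x y) ∈ 𝓑 := by
  induction t using Finset.cons_induction with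
  | empty => simpa [allOnes] using h_ones
  | cons a t ha ih =>
    simp only [Finset.prod_cons]
    exact h_had _ (hf a) _ ih

theorem transpose_classMatrix (h_tr : ∀ M ∈ 𝓑, Mᵀ ∈ 𝓑) (x y : κ) :
    (classMatrix 𝓑 (Quotient.mk _ (x, y)))ᵀ = classMatrix 𝓑 (Quotient.mk _ (y, x)) := by
  have transposed {p q : κ × κ} (h : Quotient.mk (entrySetoid 𝓑) p = Quotient.mk _ q) :
      Quotient.mk (entrySetoid 𝓑) p.swap = Quotient.mk _ q.swap :=
    mk_eq_mk_iff.mpr fun M hM => mk_eq_mk_iff.mp h Mᵀ (h_tr M hM)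
  ext i j
  classical
  simp only [transpose_apply, classMatrix, of_apply]
  exact if_congr ⟨transposed, transposed⟩ rfl rfl

theorem classMatrix_mem [Finite κ] (h_ones : allOnes κ ∈ 𝓑) (h_had : ∀ M ∈ 𝓑, ∀ N ∈ 𝓑, M ⊙ N ∈ 𝓑)
    (c : Quotient (entrySetoid 𝓑)) : classMatrix 𝓑 c ∈ 𝓑 := by
  have := Fintype.ofFinite κ
  obtain ⟨p, rfl⟩ := Quotient.exists_rep c
  have separating (q : κ × κ) : ∃ M ∈ 𝓑, M p.1 p.2 = 1 ∧
      (Quotient.mk (entrySetoid 𝓑) q ≠ Quotient.mk _ p → M q.1 q.2 = 0) := by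
    by_cases hq : Quotient.mk (entrySetoid 𝓑) q = Quotient.mk _ p
    · exact ⟨_, h_ones, rfl, fun h => absurd hq h⟩
    · obtain ⟨M, hM, hp, hq⟩ := exists_separating_mem h_ones hq
      exact ⟨M, hM, hp, fun _ => hq⟩
  choose f hf hf_one hf_zero using separating
  convert hadamard_prod_mem h_ones h_had Finset.univ hf using 1
  ext x y
  simp only [classMatrix, of_apply]
  split_ifs with hxy
  · exact (Finset.prod_eq_one fun q _ => by
      rw [← hf_one q]; exact mk_eq_mk_iff.mp hxy (f q) (hf q)).symm
  · exact (Finset.prod_eq_zero (Finset.mem_univ (x, y)) (hf_zero (x, y) hxy)).symm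

open scoped Classical in
theorem sum_classMatrix [Fintype κ] (𝓑 : Submodule ℂ (Matrix κ κ ℂ)) :
    ∑ c, classMatrix 𝓑 c = allOnes κ := by
  ext x y
  simp [Matrix.sum_apply, classMatrix, allOnes]

open scoped Classical in
theorem eq_sum_smul_classMatrix [Fintype κ] {M : Matrix κ κ ℂ} (hM : M ∈ 𝓑) :
    M = ∑ c : Quotient (entrySetoid 𝓑), M c.out.1 c.out.2 • classMatrix 𝓑 c := by
  ext x y
  simp only [Matrix.sum_apply, Matrix.smul_apply, classMatrix, of_apply, smul_eq_mul, mul_ite,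
    mul_one, mul_zero, Finset.sum_ite_eq, Finset.mem_univ, if_true]
  exact (mk_eq_mk_iff.mp (Quotient.out_eq (Quotient.mk (entrySetoid 𝓑) (x, y))) M hM).symm

theorem span_range_classMatrix [Finite κ] (h_ones : allOnes κ ∈ 𝓑)
    (h_had : ∀ M ∈ 𝓑, ∀ N ∈ 𝓑, M ⊙ N ∈ 𝓑) :
    Submodule.span ℂ (Set.range (classMatrix 𝓑)) = 𝓑 := by
  refine le_antisymm (Submodule.span_le.mpr ?_) fun M hM => ?_
  · rintro _ ⟨c, rfl⟩
    exact classMatrix_mem h_ones h_had c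
  · have := Fintype.ofFinite κ
    classical
    rw [eq_sum_smul_classMatrix hM]
    exact Submodule.sum_mem _ fun c _ =>
      Submodule.smul_mem _ _ (Submodule.subset_span ⟨c, rfl⟩)

variable [Fintype κ] [DecidableEq κ]

/-- The diagonal part of `M` commutes with the all-ones matrix. -/
theorem diag_eq_of_mem (h_one : 1 ∈ 𝓑) (h_ones : allOnes κ ∈ 𝓑)
    (h_had : ∀ M ∈ 𝓑, ∀ N ∈ 𝓑, M ⊙ N ∈ 𝓑) (h_comm : ∀ M ∈ 𝓑, ∀ N ∈ 𝓑, M * N = N * M)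
    {M : Matrix κ κ ℂ} (hM : M ∈ 𝓑) (x y : κ) : M x x = M y y := by
  have := congrFun₂ (h_comm _ (h_had M hM 1 h_one) _ h_ones) x y
  simpa [mul_apply, allOnes, Matrix.one_apply] using this

theorem classMatrix_diag (h_one : 1 ∈ 𝓑) (h_ones : allOnes κ ∈ 𝓑)
    (h_had : ∀ M ∈ 𝓑, ∀ N ∈ 𝓑, M ⊙ N ∈ 𝓑) (h_comm : ∀ M ∈ 𝓑, ∀ N ∈ 𝓑, M * N = N * M) (z : κ) :
    classMatrix 𝓑 (Quotient.mk _ (z, z)) = 1 := by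
  ext x y
  classical
  rw [classMatrix, of_apply, Matrix.one_apply]
  refine if_congr (mk_eq_mk_iff.trans ⟨fun h => ?_, ?_⟩) rfl rfl
  · by_contra hxy
    simpa [hxy] using h 1 h_one
  · rintro rfl M hM
    exact diag_eq_of_mem h_one h_ones h_had h_comm hM x z

theorem exists_equiv_fin_zero_eq {α : Type*} [Finite α] (a : α) :
    ∃ (m : ℕ) (e : Fin (m + 1) ≃ α), e 0 = a := by
  classical
  have := Fintype.ofFinite α
  have card_eq : Fintype.card α = Fintype.card α - 1 + 1 :=
    (Nat.succ_pred_eq_of_pos (Fintype.card_pos_iff.mpr ⟨a⟩)).symm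
  let e := (Fintype.equivFinOfCardEq card_eq).symm
  exact ⟨_, e.trans (Equiv.swap (e 0) a), by simp⟩

theorem isBoseMesnerAlgebra_of_closed [Nonempty κ] (h_one : 1 ∈ 𝓑) (h_ones : allOnes κ ∈ 𝓑)
    (h_had : ∀ M ∈ 𝓑, ∀ N ∈ 𝓑, M ⊙ N ∈ 𝓑) (h_mul : ∀ M ∈ 𝓑, ∀ N ∈ 𝓑, M * N ∈ 𝓑)
    (h_tr : ∀ M ∈ 𝓑, Mᵀ ∈ 𝓑) (h_comm : ∀ M ∈ 𝓑, ∀ N ∈ 𝓑, M * N = N * M) :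
    IsBoseMesnerAlgebra 𝓑 := by
  classical
  let z : κ := Classical.arbitrary κ
  obtain ⟨m, e, he⟩ := exists_equiv_fin_zero_eq (Quotient.mk (entrySetoid 𝓑) (z, z))
  have mem (k) : classMatrix 𝓑 (e k) ∈ 𝓑 := classMatrix_mem h_ones h_had _
  have span_eq : Submodule.span ℂ (Set.range fun k => classMatrix 𝓑 (e k)) = 𝓑 :=
    (congrArg _ (e.surjective.range_comp (classMatrix 𝓑))).trans
      (span_range_classMatrix h_ones h_had)
  refine ⟨m, fun k => classMatrix 𝓑 (e k), ?_, span_eq.symm⟩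
  exact {
    zero_or_one := fun k => classMatrix_eq_zero_or_one (e k)
    ne_zero := fun k => classMatrix_ne_zero (e k)
    zero_eq_one := by simp only [he, z, classMatrix_diag h_one h_ones h_had h_comm]
    sum_eq := by rw [Equiv.sum_comp e (classMatrix 𝓑), sum_classMatrix]
    transpose_mem := fun k => by
      obtain ⟨⟨x, y⟩, hxy⟩ := Quotient.exists_rep (e k)
      exact ⟨e.symm (Quotient.mk _ (y, x)), by
        rw [← hxy, transpose_classMatrix h_tr, e.apply_symm_apply]⟩
    mul_mem := fun k l => span_eq.symm ▸ h_mul _ (mem k) _ (mem l)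
    mul_comm := fun k l => h_comm _ (mem k) _ (mem l) }

end BoseMesner

section BlockMatrix

variable {ι : Type*} (F G R R₁ F' G' R' R₁' : Matrix ι ι ℂ)

theorem blockMatrix_add :
    blockMatrix F R G R₁ + blockMatrix F' R' G' R₁' =
      blockMatrix (F + F') (R + R') (G + G') (R₁ + R₁') := by
  ext ((i | i) | (i | i)) ((j | j) | (j | j)) <;> simp [blockMatrix] <;> ring

theorem smul_blockMatrix (c : ℂ) :
    c • blockMatrix F R G R₁ = blockMatrix (c • F) (c • R) (c • G) (c • R₁) := by
  ext ((i | i) | (i | i)) ((j | j) | (j | j)) <;> simp [blockMatrix] <;> ring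

theorem transpose_blockMatrix : (blockMatrix F R G R₁)ᵀ = blockMatrix Fᵀ Rᵀ Gᵀ R₁ᵀ := by
  ext ((i | i) | (i | i)) ((j | j) | (j | j)) <;> simp [blockMatrix]

theorem blockMatrix_hadamard :
    blockMatrix F R G R₁ ⊙ blockMatrix F' R' G' R₁' =
      blockMatrix (F ⊙ F' + R ⊙ R') (F ⊙ R' + F' ⊙ R) (G ⊙ G' + R₁ ⊙ R₁')
        (G ⊙ R₁' + G' ⊙ R₁) := by
  ext ((i | i) | (i | i)) ((j | j) | (j | j)) <;> simp [blockMatrix] <;> ring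

theorem blockMatrix_mul [Fintype ι] :
    blockMatrix F R G R₁ * blockMatrix F' R' G' R₁' =
      (2 : ℂ) • blockMatrix (F * F') (R * R') (G * G') (R₁ * R₁') := by
  simp only [blockMatrix, fromBlocks_multiply, two_smul, fromBlocks_add, Matrix.mul_zero,
    Matrix.zero_mul, add_zero, zero_add]
  congr 2 <;> noncomm_ring

theorem one_eq_blockMatrix [DecidableEq ι] :
    (1 : Matrix (Four ι) (Four ι) ℂ) = (1 / 2 : ℂ) • blockMatrix 1 1 1 1 := by
  ext ((i | i) | (i | i)) ((j | j) | (j | j)) <;>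
    simp [blockMatrix, Matrix.one_apply] <;> split_ifs <;> norm_num

theorem allOnes_eq_blockMatrix_add_hatJ :
    allOnes (Four ι) = blockMatrix (allOnes ι) 0 (allOnes ι) 0 + hatJ ι := by
  ext ((i | i) | (i | i)) ((j | j) | (j | j)) <;> simp [allOnes, blockMatrix, hatJ]

theorem allOnes_sum_eq_fromBlocks :
    allOnes (ι ⊕ ι) = fromBlocks (allOnes ι) (allOnes ι) (allOnes ι) (allOnes ι) := by
  ext (i | i) (_ | _) <;> simp [allOnes]

theorem transpose_hatJ (ι : Type*) : (hatJ ι)ᵀ = hatJ ι := by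
  ext ((i | i) | (i | i)) ((_ | _) | (_ | _)) <;> simp [hatJ, allOnes]

theorem hatJ_hadamard_self (ι : Type*) : hatJ ι ⊙ hatJ ι = hatJ ι := by
  ext ((i | i) | (i | i)) ((j | j) | (j | j)) <;> simp [hatJ, allOnes]

theorem blockMatrix_hadamard_hatJ : blockMatrix F R G R₁ ⊙ hatJ ι = 0 := by
  ext ((i | i) | (i | i)) ((j | j) | (j | j)) <;> simp [blockMatrix, hatJ]

theorem hatJ_mul_self (ι : Type*) [Fintype ι] :
    hatJ ι * hatJ ι =
      (2 * (Fintype.card ι : ℂ)) • blockMatrix (allOnes ι) 0 (allOnes ι) 0 := by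
  have allOnes_mul_self : allOnes ι * allOnes ι = (Fintype.card ι : ℂ) • allOnes ι := by
    ext i j
    simp [Matrix.mul_apply, allOnes]
  simp only [hatJ, blockMatrix, allOnes_sum_eq_fromBlocks, fromBlocks_multiply, fromBlocks_smul,
    Matrix.mul_zero, Matrix.zero_mul, add_zero, zero_add, smul_zero, sub_zero, allOnes_mul_self,
    mul_smul, two_smul, fromBlocks_add]

variable {F G R R₁ F' G' R' R₁'}

theorem blockMatrix_mul_hatJ [Fintype ι] {c : ℂ} (hF : F * allOnes ι = c • allOnes ι)
    (hG : G * allOnes ι = c • allOnes ι) (R R₁ : Matrix ι ι ℂ) :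
    blockMatrix F R G R₁ * hatJ ι = (2 * c) • hatJ ι := by
  have block_row {F : Matrix ι ι ℂ} (hF : F * allOnes ι = c • allOnes ι) (R : Matrix ι ι ℂ) :
      (F + R) * allOnes ι + (F - R) * allOnes ι = (2 * c) • allOnes ι := by
    rw [mul_smul, ← hF, two_smul]
    noncomm_ring
  have block_row' {F : Matrix ι ι ℂ} (hF : F * allOnes ι = c • allOnes ι) (R : Matrix ι ι ℂ) :
      (F - R) * allOnes ι + (F + R) * allOnes ι = (2 * c) • allOnes ι := by
    rw [add_comm, block_row hF]
  simp only [hatJ, blockMatrix, allOnes_sum_eq_fromBlocks, fromBlocks_multiply, fromBlocks_smul,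
    Matrix.mul_zero, Matrix.zero_mul, add_zero, zero_add, smul_zero, block_row hF, block_row hG,
    block_row' hF, block_row' hG]

theorem hatJ_mul_blockMatrix [Fintype ι] {c : ℂ} (hF : allOnes ι * F = c • allOnes ι)
    (hG : allOnes ι * G = c • allOnes ι) (R R₁ : Matrix ι ι ℂ) :
    hatJ ι * blockMatrix F R G R₁ = (2 * c) • hatJ ι := by
  have transpose_mul_allOnes {F : Matrix ι ι ℂ} (hF : allOnes ι * F = c • allOnes ι) :
      Fᵀ * allOnes ι = c • allOnes ι := by
    rw [show allOnes ι = (allOnes ι)ᵀ from rfl, ← transpose_mul, hF, transpose_smul]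
  rw [← transpose_inj, transpose_mul, transpose_blockMatrix, transpose_hatJ,
    blockMatrix_mul_hatJ (transpose_mul_allOnes hF) (transpose_mul_allOnes hG), transpose_smul,
    transpose_hatJ]

/-- `blockMatrix` as a linear map on pairs `((F, G), (R, R₁))` of an even and an odd part. -/
def blockLinear (ι : Type*) :
    (Matrix ι ι ℂ × Matrix ι ι ℂ) × (Matrix ι ι ℂ × Matrix ι ι ℂ) →ₗ[ℂ]
      Matrix (Four ι) (Four ι) ℂ where
  toFun p := blockMatrix p.1.1 p.2.1 p.1.2 p.2.2
  map_add' _ _ := (blockMatrix_add ..).symm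
  map_smul' _ _ := (smul_blockMatrix ..).symm

theorem blockLinear_injective (ι : Type*) : Function.Injective (blockLinear ι) := by
  rw [injective_iff_map_eq_zero]
  rintro ⟨⟨F, G⟩, R, R₁⟩ hZ
  have eq_zero {M N : Matrix ι ι ℂ} (hadd : ∀ i j, M i j + N i j = 0)
      (hsub : ∀ i j, M i j - N i j = 0) : M = 0 ∧ N = 0 :=
    ⟨ext fun i j => by rw [Matrix.zero_apply]; linear_combination (hadd i j + hsub i j) / 2,
      ext fun i j => by rw [Matrix.zero_apply]; linear_combination (hadd i j - hsub i j) / 2⟩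
  obtain ⟨rfl, rfl⟩ : F = 0 ∧ R = 0 := eq_zero
    (fun i j => congrFun₂ hZ (Sum.inl (Sum.inl i)) (Sum.inl (Sum.inl j)))
    (fun i j => congrFun₂ hZ (Sum.inl (Sum.inl i)) (Sum.inl (Sum.inr j)))
  obtain ⟨rfl, rfl⟩ : G = 0 ∧ R₁ = 0 := eq_zero
    (fun i j => congrFun₂ hZ (Sum.inr (Sum.inl i)) (Sum.inr (Sum.inl j)))
    (fun i j => congrFun₂ hZ (Sum.inr (Sum.inl i)) (Sum.inr (Sum.inr j)))
  rfl

theorem hatJ_notMem_range_blockLinear (ι : Type*) [Nonempty ι] :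
    hatJ ι ∉ LinearMap.range (blockLinear ι) := by
  rintro ⟨⟨⟨F, G⟩, R, R₁⟩, hJ⟩
  let x := Classical.arbitrary ι
  simpa [blockLinear, blockMatrix, hatJ, allOnes] using
    congrFun₂ hJ (Sum.inl (Sum.inl x)) (Sum.inr (Sum.inl x))

end BlockMatrix

namespace IsInvertibleJonesPair

variable {ι : Type*} [Fintype ι] [DecidableEq ι] [Nonempty ι]
  {A B F G F' G' R R₁ R' R₁' : Matrix ι ι ℂ} {Y Z : Matrix (Four ι) (Four ι) ℂ}

theorem spanHat_eq_sup (h : IsInvertibleJonesPair A B) (hA : A.IsSymm) :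
    spanHat A B = ((evenPairs A B).prod (oddPairs A B)).map (blockLinear ι) ⊔
      Submodule.span ℂ {hatJ ι} := by
  have hatS_eq : hatS A B = ((evenPairs A B).prod (oddPairs A B)).map (blockLinear ι) := by
    ext Z
    rw [h.mem_hatS_iff hA]
    constructor
    · rintro ⟨F, G, R, R₁, hF, hR, rfl⟩
      exact ⟨((F, G), (R, R₁)), ⟨hF, hR⟩, rfl⟩
    · rintro ⟨⟨⟨F, G⟩, R, R₁⟩, ⟨hF, hR⟩, rfl⟩
      exact ⟨F, G, R, R₁, hF, hR, rfl⟩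
  rw [spanHat, Submodule.span_union, hatS_eq, Submodule.span_eq]

theorem blockMatrix_mem_spanHat (h : IsInvertibleJonesPair A B) (hA : A.IsSymm)
    (hF : (F, G) ∈ evenPairs A B) (hR : (R, R₁) ∈ oddPairs A B) :
    blockMatrix F R G R₁ ∈ spanHat A B :=
  Submodule.subset_span (Or.inl ((h.mem_hatS_iff hA).mpr ⟨F, G, R, R₁, hF, hR, rfl⟩))

theorem mem_spanHat_iff (h : IsInvertibleJonesPair A B) (hA : A.IsSymm) :
    Z ∈ spanHat A B ↔ ∃ F G R R₁, ∃ c : ℂ, (F, G) ∈ evenPairs A B ∧ (R, R₁) ∈ oddPairs A B ∧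
      Z = blockMatrix F R G R₁ + c • hatJ ι := by
  rw [h.spanHat_eq_sup hA, Submodule.mem_sup]
  constructor
  · rintro ⟨_, ⟨⟨⟨F, G⟩, R, R₁⟩, ⟨hF, hR⟩, rfl⟩, Y, hY, rfl⟩
    obtain ⟨c, rfl⟩ := Submodule.mem_span_singleton.mp hY
    exact ⟨F, G, R, R₁, c, hF, hR, rfl⟩
  · rintro ⟨F, G, R, R₁, c, hF, hR, rfl⟩
    exact ⟨_, ⟨((F, G), (R, R₁)), ⟨hF, hR⟩, rfl⟩, _,
      Submodule.smul_mem _ c (Submodule.mem_span_singleton_self _), rfl⟩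

theorem finrank_evenPairs (h : IsInvertibleJonesPair A B) (hA : A.IsSymm) :
    Module.finrank ℂ (evenPairs A B) = Module.finrank ℂ (nomura A) := by
  let graph : Matrix ι ι ℂ →ₗ[ℂ] Matrix ι ι ℂ × Matrix ι ι ℂ :=
    LinearMap.id.prod (LinearMap.mulLeftRight ℂ (B⁻¹, B))
  have map_graph : (nomura A).map graph = evenPairs A B := by
    ext ⟨F, G⟩
    rw [h.mem_evenPairs_iff_conj hA]
    constructor
    · rintro ⟨F, hF, ⟨⟩⟩
      exact ⟨hF, rfl⟩
    · rintro ⟨hF, rfl⟩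
      exact ⟨F, hF, rfl⟩
  have graph_injective : Function.Injective graph := fun _ _ => congrArg Prod.fst
  rw [← map_graph, ← (Submodule.equivMapOfInjective graph graph_injective _).finrank_eq]

theorem finrank_oddPairs (h : IsInvertibleJonesPair A B) (hA : A.IsSymm) :
    Module.finrank ℂ (oddPairs A B) = Module.finrank ℂ (evenPairs A B) := by
  have cancel (M : Matrix ι ι ℂ) : A ⊙ (schurInv A ⊙ M) = M := by
    ext i j
    exact mul_inv_cancel_left₀ (h.schurInvertible i j) (M i j)
  have map_opDelta : (oddPairs A B).map ((opDelta A).prodMap (opDelta A)) = evenPairs A B := by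
    ext ⟨F, G⟩
    constructor
    · rintro ⟨⟨R, R₁⟩, hR, ⟨⟩⟩
      exact (h.mem_oddPairs_iff hA).mp hR
    · intro hF
      refine ⟨(schurInv A ⊙ F, schurInv A ⊙ G), (h.mem_oddPairs_iff hA).mpr ?_,
        Prod.ext (cancel F) (cancel G)⟩
      rwa [cancel, cancel]
  have opDelta_injective : Function.Injective (opDelta A) := fun M N hMN => by
    ext i j
    exact mul_left_cancel₀ (h.schurInvertible i j) (congrFun₂ hMN i j)
  rw [← map_opDelta, ← (Submodule.equivMapOfInjective _
    (opDelta_injective.prodMap opDelta_injective) _).finrank_eq]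

theorem finrank_spanHat (h : IsInvertibleJonesPair A B) (hA : A.IsSymm) :
    Module.finrank ℂ (spanHat A B) = 2 * Module.finrank ℂ (nomura A) + 1 := by
  let pairs := (evenPairs A B).subtype.prodMap (oddPairs A B).subtype
  have blocks_injective : Function.Injective (blockLinear ι ∘ₗ pairs) :=
    (blockLinear_injective ι).comp (Subtype.val_injective.prodMap Subtype.val_injective)
  have range_pairs : LinearMap.range pairs = (evenPairs A B).prod (oddPairs A B) := by
    rw [LinearMap.range_prodMap, Submodule.range_subtype, Submodule.range_subtype]
  rw [h.spanHat_eq_sup hA, Submodule.finrank_sup_span_singleton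
      fun hJ => hatJ_notMem_range_blockLinear ι (LinearMap.map_le_range hJ),
    ← range_pairs, ← LinearMap.range_comp,
    LinearMap.finrank_range_of_inj blocks_injective,
    Module.finrank_prod, h.finrank_oddPairs hA, h.finrank_evenPairs hA, two_mul]

theorem one_mem_spanHat (h : IsInvertibleJonesPair A B) (hA : A.IsSymm) : 1 ∈ spanHat A B := by
  rw [one_eq_blockMatrix]
  exact Submodule.smul_mem _ _
    (h.blockMatrix_mem_spanHat hA (pairedNomura.one_mem ..) (pairedNomura.one_mem ..))

theorem allOnes_mem_spanHat (h : IsInvertibleJonesPair A B) (hA : A.IsSymm) :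
    allOnes (Four ι) ∈ spanHat A B :=
  (h.mem_spanHat_iff hA).mpr ⟨_, _, 0, 0, 1, h.allOnes_mem_evenPairs, zero_mem _,
    by rw [allOnes_eq_blockMatrix_add_hatJ, one_smul]⟩

theorem transpose_mem_spanHat (h : IsInvertibleJonesPair A B) (hA : A.IsSymm)
    (hZ : Z ∈ spanHat A B) : Zᵀ ∈ spanHat A B := by
  obtain ⟨F, G, R, R₁, c, hF, hR, rfl⟩ := (h.mem_spanHat_iff hA).mp hZ
  refine (h.mem_spanHat_iff hA).mpr ⟨_, _, _, _, c, h.transpose_mem_evenPairs hF,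
    h.transpose_mem_oddPairs hA hR, ?_⟩
  rw [transpose_add, transpose_smul, transpose_hatJ, transpose_blockMatrix]

theorem hadamard_mem_spanHat (h : IsInvertibleJonesPair A B) (hA : A.IsSymm)
    (hY : Y ∈ spanHat A B) (hZ : Z ∈ spanHat A B) : Y ⊙ Z ∈ spanHat A B := by
  obtain ⟨F, G, R, R₁, c, hF, hR, rfl⟩ := (h.mem_spanHat_iff hA).mp hY
  obtain ⟨F', G', R', R₁', c', hF', hR', rfl⟩ := (h.mem_spanHat_iff hA).mp hZ
  have even := add_mem (h.hadamard_mem_evenPairs hF hF') (h.hadamard_odd_mem_evenPairs hA hR hR')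
  have odd := add_mem (h.hadamard_mem_oddPairs hF hR') (h.hadamard_mem_oddPairs hF' hR)
  rw [Prod.mk_add_mk] at even odd
  refine (h.mem_spanHat_iff hA).mpr ⟨_, _, _, _, c * c', even, odd, ?_⟩
  simp only [add_hadamard, hadamard_add, smul_hadamard, hadamard_smul, blockMatrix_hadamard,
    hadamard_comm (hatJ ι) (blockMatrix F' R' G' R₁'), blockMatrix_hadamard_hatJ,
    hatJ_hadamard_self, smul_smul, smul_zero, add_zero, zero_add, mul_comm c']

theorem exists_mul_hatJ (h : IsInvertibleJonesPair A B) (hF : (F, G) ∈ evenPairs A B)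
    (R R₁ : Matrix ι ι ℂ) : ∃ c : ℂ, blockMatrix F R G R₁ * hatJ ι = c • hatJ ι ∧
      hatJ ι * blockMatrix F R G R₁ = c • hatJ ι := by
  obtain ⟨c, hFc, hGc⟩ := h.exists_mul_allOnes hF
  obtain ⟨hFJ, hGJ⟩ := h.commute_of_mem_evenPairs hF h.allOnes_mem_evenPairs
  exact ⟨2 * c, blockMatrix_mul_hatJ hFc hGc R R₁,
    hatJ_mul_blockMatrix (hFJ.symm.trans hFc) (hGJ.symm.trans hGc) R R₁⟩

theorem mul_mem_spanHat (h : IsInvertibleJonesPair A B) (hA : A.IsSymm)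
    (hY : Y ∈ spanHat A B) (hZ : Z ∈ spanHat A B) : Y * Z ∈ spanHat A B := by
  obtain ⟨F, G, R, R₁, c, hF, hR, rfl⟩ := (h.mem_spanHat_iff hA).mp hY
  obtain ⟨F', G', R', R₁', c', hF', hR', rfl⟩ := (h.mem_spanHat_iff hA).mp hZ
  obtain ⟨a, hmul, -⟩ := h.exists_mul_hatJ hF R R₁
  obtain ⟨a', -, hmul'⟩ := h.exists_mul_hatJ hF' R' R₁'
  have hatJ_mem : hatJ ι ∈ spanHat A B := Submodule.subset_span (Or.inr rfl)
  simp only [Matrix.add_mul, Matrix.mul_add, Matrix.smul_mul, Matrix.mul_smul, hmul, hmul',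
    blockMatrix_mul, hatJ_mul_self]
  have product_mem := h.blockMatrix_mem_spanHat hA (pairedNomura.mul_mem hF hF')
    (pairedNomura.mul_mem hR hR')
  have ones_mem := h.blockMatrix_mem_spanHat hA h.allOnes_mem_evenPairs (zero_mem (oddPairs A B))
  apply_rules [add_mem, Submodule.smul_mem]

theorem commute_of_mem_spanHat (h : IsInvertibleJonesPair A B) (hA : A.IsSymm)
    (hY : Y ∈ spanHat A B) (hZ : Z ∈ spanHat A B) : Y * Z = Z * Y := by
  obtain ⟨F, G, R, R₁, c, hF, hR, rfl⟩ := (h.mem_spanHat_iff hA).mp hY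
  obtain ⟨F', G', R', R₁', c', hF', hR', rfl⟩ := (h.mem_spanHat_iff hA).mp hZ
  obtain ⟨a, hmul_hatJ, hhatJ_mul⟩ := h.exists_mul_hatJ hF R R₁
  obtain ⟨a', hmul_hatJ', hhatJ_mul'⟩ := h.exists_mul_hatJ hF' R' R₁'
  obtain ⟨hFF', hGG'⟩ := h.commute_of_mem_evenPairs hF hF'
  obtain ⟨hRR', hRR₁'⟩ := h.commute_of_mem_oddPairs hR hR'
  simp only [Matrix.add_mul, Matrix.mul_add, Matrix.smul_mul, Matrix.mul_smul, blockMatrix_mul,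
    hFF', hGG', hRR', hRR₁', hmul_hatJ, hhatJ_mul, hmul_hatJ', hhatJ_mul']
  module

theorem isBoseMesnerAlgebra_spanHat (h : IsInvertibleJonesPair A B) (hA : A.IsSymm) :
    IsBoseMesnerAlgebra (spanHat A B) :=
  isBoseMesnerAlgebra_of_closed (h.one_mem_spanHat hA) (h.allOnes_mem_spanHat hA)
    (fun _ hY _ hZ => h.hadamard_mem_spanHat hA hY hZ)
    (fun _ hY _ hZ => h.mul_mem_spanHat hA hY hZ)
    (fun _ hZ => h.transpose_mem_spanHat hA hZ)
    (fun _ hY _ hZ => h.commute_of_mem_spanHat hA hY hZ)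

end IsInvertibleJonesPair

section FourVec

variable {ι : Type*}

/-- The vector with the four parts `f, e f, g, e g`, the shape of all vectors `V e_p ∘ V⁽⁻⁾ e_q`:
`e = 1` for `p`, `q` in the same half of the columns of `V` and `e = -1` otherwise. -/
def fourVec (e : ℂ) (f g : ι → ℂ) : Four ι → ℂ :=
  Sum.elim (Sum.elim f (e • f)) (Sum.elim g (e • g))

theorem blockMatrix_mulVec_fourVec_one [Fintype ι] {F G : Matrix ι ι ℂ} {f g : ι → ℂ} {c : ℂ}
    (hf : F *ᵥ f = c • f) (hg : G *ᵥ g = c • g) (R R₁ : Matrix ι ι ℂ) :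
    blockMatrix F R G R₁ *ᵥ fourVec 1 f g = (2 * c) • fourVec 1 f g := by
  ext ((i | i) | (i | i)) <;>
    simp [blockMatrix, fourVec, fromBlocks_mulVec, add_mulVec, sub_mulVec, hf, hg] <;> ring

theorem blockMatrix_mulVec_fourVec_neg_one [Fintype ι] {R R₁ : Matrix ι ι ℂ} {f g : ι → ℂ} {c : ℂ}
    (hf : R *ᵥ f = c • f) (hg : R₁ *ᵥ g = c • g) (F G : Matrix ι ι ℂ) :
    blockMatrix F R G R₁ *ᵥ fourVec (-1) f g = (2 * c) • fourVec (-1) f g := by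
  ext ((i | i) | (i | i)) <;>
    simp [blockMatrix, fourVec, fromBlocks_mulVec, add_mulVec, sub_mulVec, mulVec_neg, hf, hg] <;>
    ring

theorem hatJ_mulVec_fourVec [Fintype ι] (e : ℂ) (f g : ι → ℂ) :
    hatJ ι *ᵥ fourVec e f g =
      Sum.elim (fun _ => (1 + e) * ∑ k, g k) (fun _ => (1 + e) * ∑ k, f k) := by
  ext ((i | i) | (i | i)) <;>
    simp [hatJ, fourVec, mulVec, dotProduct, allOnes, add_mul, Finset.mul_sum,
      Finset.sum_add_distrib]

/-- The sign of the block `dA` in a column of `V` inside either half of its columns. -/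
def colSign : ι ⊕ ι → ℂ := Sum.elim (fun _ => 1) (fun _ => -1)

/-- The index of a column of `V` inside its block. -/
def colIndex : ι ⊕ ι → ι := Sum.elim id id

theorem colSign_mul_self (p : ι ⊕ ι) : colSign p * colSign p = 1 := by
  rcases p with i | i <;> simp [colSign]

variable {A B : Matrix ι ι ℂ} {d : ℂ} (p q : ι ⊕ ι)

theorem evec_matV_inl_inl (hd : d ≠ 0) :
    evec (matV d A B) (schurInv (matV d A B)) (Sum.inl p) (Sum.inl q) =
      fourVec 1 ((colSign p * colSign q) • evec A (schurInv A) (colIndex p) (colIndex q))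
        (evec (schurInv B)ᵀ Bᵀ (colIndex p) (colIndex q)) := by
  ext ((k | k) | (k | k)) <;> rcases p with i | i <;> rcases q with j | j <;>
    simp [evec, matV, fourVec, colSign, colIndex, schurInv_apply] <;> field_simp

theorem evec_matV_inr_inr (hd : d ≠ 0) :
    evec (matV d A B) (schurInv (matV d A B)) (Sum.inr p) (Sum.inr q) =
      fourVec 1 (evec (schurInv B) B (colIndex p) (colIndex q))
        ((colSign p * colSign q) • evec A (schurInv A) (colIndex p) (colIndex q)) := by
  ext ((k | k) | (k | k)) <;> rcases p with i | i <;> rcases q with j | j <;>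
    simp [evec, matV, fourVec, colSign, colIndex, schurInv_apply] <;> field_simp

theorem evec_matV_inl_inr :
    evec (matV d A B) (schurInv (matV d A B)) (Sum.inl p) (Sum.inr q) =
      fourVec (-1) ((colSign p * d) • evec A B (colIndex p) (colIndex q))
        ((colSign q * d⁻¹) • evec (schurInv B)ᵀ (schurInv A) (colIndex p) (colIndex q)) := by
  ext ((k | k) | (k | k)) <;> rcases p with i | i <;> rcases q with j | j <;>
    simp [evec, matV, fourVec, colSign, colIndex, schurInv_apply] <;> ring

theorem evec_matV_inr_inl :
    evec (matV d A B) (schurInv (matV d A B)) (Sum.inr p) (Sum.inl q) =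
      fourVec (-1) ((colSign q * d⁻¹) • evec (schurInv B) (schurInv A) (colIndex p) (colIndex q))
        ((colSign p * d) • evec A Bᵀ (colIndex p) (colIndex q)) := by
  ext ((k | k) | (k | k)) <;> rcases p with i | i <;> rcases q with j | j <;>
    simp [evec, matV, fourVec, colSign, colIndex, schurInv_apply] <;> ring

end FourVec

section HatJ

variable {ι : Type*} [Fintype ι] [DecidableEq ι] {C D : Matrix ι ι ℂ} {a b : ℂ} {i j : ι}

theorem evec_schurInv_self {ι : Type*} {C : Matrix ι ι ℂ} (hC : ∀ i j, C i j ≠ 0) (i : ι) :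
    evec C (schurInv C) i i = 1 :=
  funext fun k => mul_inv_cancel₀ (hC k i)

theorem IsTypeII.sum_evec_of_ne [Nonempty ι] (hC : IsTypeII C) (hij : i ≠ j) :
    ∑ k, evec C (JonesPair.schurInv C) i j k = 0 := by
  have := congrFun (IsEigMatrix.allOnes hC i j) (Classical.arbitrary ι)
  simpa [JonesPair.allOnes, mulVec, dotProduct, hij] using this

theorem exists_hatJ_mulVec_eq_smul [Nonempty ι] (hC : IsTypeII C) (hD : IsTypeII D) (i j : ι)
    (ha : a * a = 1) (hb : b * b = 1) :
    ∃ c : ℂ, hatJ ι *ᵥ fourVec 1 (a • evec C (schurInv C) i j) (b • evec D (schurInv D) i j) =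
      c • fourVec 1 (a • evec C (schurInv C) i j) (b • evec D (schurInv D) i j) := by
  rw [hatJ_mulVec_fourVec]
  by_cases hij : i = j
  · subst hij
    refine ⟨2 * a * b * Fintype.card ι, ?_⟩
    rw [evec_schurInv_self hC.ne_zero, evec_schurInv_self hD.ne_zero]
    ext ((k | k) | (k | k)) <;> simp [fourVec] <;> grind
  · refine ⟨0, ?_⟩
    simp only [Pi.smul_apply, ← Finset.smul_sum, hC.sum_evec_of_ne hij, hD.sum_evec_of_ne hij]
    ext (k | k) <;> simp

end HatJ

namespace IsInvertibleJonesPair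

variable {ι : Type*} [Fintype ι] [DecidableEq ι] [Nonempty ι] {A B F G R R₁ : Matrix ι ι ℂ} {d : ℂ}

theorem hatJ_mem_nomura_matV (h : IsInvertibleJonesPair A B) (hd : d ≠ 0) :
    hatJ ι ∈ nomura (matV d A B) := by
  have sign_sq (p q : ι ⊕ ι) : colSign p * colSign q * (colSign p * colSign q) = 1 := by
    rw [mul_mul_mul_comm, colSign_mul_self, colSign_mul_self, one_mul]
  have hatJ_odd (f g : ι → ℂ) :
      ∃ c : ℂ, hatJ ι *ᵥ fourVec (-1) f g = c • fourVec (-1) f g := by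
    refine ⟨0, ?_⟩
    rw [hatJ_mulVec_fourVec]
    ext (k | k) <;> simp
  rintro (p | p) (q | q)
  · rw [evec_matV_inl_inl p q hd]
    simpa only [one_smul, ← transpose_schurInv, schurInv_schurInv] using
      exists_hatJ_mulVec_eq_smul h.isTypeII_left h.isTypeII_right.schurInv.transpose
        (colIndex p) (colIndex q) (sign_sq p q) (one_mul 1)
  · rw [evec_matV_inl_inr]
    exact hatJ_odd _ _
  · rw [evec_matV_inr_inl]
    exact hatJ_odd _ _
  · rw [evec_matV_inr_inr p q hd]
    simpa only [one_smul, schurInv_schurInv] using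
      exists_hatJ_mulVec_eq_smul h.isTypeII_right.schurInv h.isTypeII_left
        (colIndex p) (colIndex q) (one_mul 1) (sign_sq p q)

theorem blockMatrix_mem_nomura_matV (h : IsInvertibleJonesPair A B) (hA : A.IsSymm) (hd : d ≠ 0)
    (hF : (F, G) ∈ evenPairs A B) (hR : (R, R₁) ∈ oddPairs A B) :
    blockMatrix F R G R₁ ∈ nomura (matV d A B) := by
  have smul_eig {M : Matrix ι ι ℂ} {v : ι → ℂ} {c : ℂ} (hv : M *ᵥ v = c • v) (s : ℂ) :
      M *ᵥ (s • v) = c • (s • v) := by rw [mulVec_smul, hv, smul_comm]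
  rintro (p | p) (q | q)
  · obtain ⟨S, hFS, hGS⟩ := hF
    rw [evec_matV_inl_inl p q hd]
    exact ⟨_, blockMatrix_mulVec_fourVec_one (smul_eig (hFS _ _) _) (hGS _ _) R R₁⟩
  · obtain ⟨S, hRS, hR₁S⟩ := hR
    rw [evec_matV_inl_inr]
    exact ⟨_, blockMatrix_mulVec_fourVec_neg_one (smul_eig (hRS _ _) _) (smul_eig (hR₁S _ _) _) F G⟩
  · obtain ⟨S, hR₁S, hRS⟩ := h.swap_mem_oddPairs hA hR
    rw [evec_matV_inr_inl]
    exact ⟨_, blockMatrix_mulVec_fourVec_neg_one (smul_eig (hRS _ _) _) (smul_eig (hR₁S _ _) _) F G⟩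
  · obtain ⟨S, hGS, hFS⟩ := h.swap_mem_evenPairs hA hF
    rw [evec_matV_inr_inr p q hd]
    exact ⟨_, blockMatrix_mulVec_fourVec_one (hFS _ _) (smul_eig (hGS _ _) _) R R₁⟩

theorem spanHat_le_nomura_matV (h : IsInvertibleJonesPair A B) (hA : A.IsSymm) (hd : d ≠ 0) :
    spanHat A B ≤ nomura (matV d A B) := by
  intro Z hZ
  obtain ⟨F, G, R, R₁, c, hF, hR, rfl⟩ := (h.mem_spanHat_iff hA).mp hZ
  exact add_mem (h.blockMatrix_mem_nomura_matV hA hd hF hR)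
    (Submodule.smul_mem _ c (h.hatJ_mem_nomura_matV hd))

end IsInvertibleJonesPair

end JonesPair

theorem mainTheorem9_general {ι : Type*} [Fintype ι] [DecidableEq ι] [Nonempty ι] {d : ℂ}
    (hd : d ≠ 0) {A B : Matrix ι ι ℂ} (hA : A.IsSymm)
    (hAB : JonesPair.IsInvertibleJonesPair A B) :
    JonesPair.IsBoseMesnerAlgebra (JonesPair.spanHat A B) ∧
      JonesPair.spanHat A B ≤ JonesPair.nomura (JonesPair.matV d A B) ∧
      Module.finrank ℂ (JonesPair.spanHat A B) =
        2 * Module.finrank ℂ (JonesPair.nomura A) + 1 :=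
  ⟨hAB.isBoseMesnerAlgebra_spanHat hA, hAB.spanHat_le_nomura_matV hA hd, hAB.finrank_spanHat hA⟩

theorem mainTheorem9 (n : ℕ) (hn : 0 < n) (d : ℂ) (hd : d ^ 2 = (n : ℂ))
    (A B : Matrix (Fin n) (Fin n) ℂ) (hA : A.IsSymm)
    (hAB : JonesPair.IsInvertibleJonesPair A B) :
    JonesPair.IsBoseMesnerAlgebra (JonesPair.spanHat A B) ∧
      JonesPair.spanHat A B ≤ JonesPair.nomura (JonesPair.matV d A B) ∧
      Module.finrank ℂ (JonesPair.spanHat A B) =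
        2 * Module.finrank ℂ (JonesPair.nomura A) + 1 := by
  have : Nonempty (Fin n) := ⟨⟨0, hn⟩⟩
  have hd₀ : d ≠ 0 := by
    rintro rfl
    exact hn.ne (by exact_mod_cast (zero_pow two_ne_zero).symm.trans hd)
  exact mainTheorem9_general hd₀ hA hAB
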